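/- Let $f$ be a transcendental (that is, non-rational) meromorphic function in $\mathbb{C}$. Let $k\ge 1$ be an integer, let $q_0,q_1,\dots,q_k\ge 0$ be integers with $q_0\ge 1$ and $q_k\ge 1$, let $a\in\mathbb{C}\setminus\{0\}$, and put $$M[f]=a\,f^{q_0}(f')^{q_1}\cdots(f^{(k)})^{q_k},\qquad \mu=\sum_{i=0}^{k}q_i,\qquad \mu_*=\sum_{i=1}^{k} i\,q_i .$$ Assume that $\mu-\mu_*\ge 3$. Then $$T(r,f)\le \frac{1}{\mu-\mu_*-2}\,\overline{N}\!\left(r,\frac{1}{M[f]-1}\right)+S(r,f)\qquad (r>0),$$ where $T(r,f)$ is the Nevanlinna characteristic of $f$, $\overline{N}(r,g)$ is the reduced Nevanlinna counting function of the poles of $g$ (each pole counted once, irrespective of multiplicity), and $S(r,f)$ is a quantity satisfying $S(r,f)=o(T(r,f))$ as $r\to\infty$, $r\notin E$, for some set $E$ of positive real numbers of finite Lebesgue measure. Moreover, for every $c\in\mathbb{C}\setminus\{0\}$ the meromorphic function $M[f]$ assumes the value $c$ at infinitely many points of $\mathbb{C}$. -/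

import Mathlib

open Filter Topology

namespace DiffMonomial

noncomputable section

/-- A transcendental meromorphic function on the complex plane: a meromorphic function that is not
a rational function. As usual for meromorphic functions in Mathlib, the values of `f` on a discrete
closed set are irrelevant, so being rational means agreeing with a quotient of polynomials
off such a set. -/
def IsTranscendentalMeromorphic (f : ℂ → ℂ) : Prop :=
  Meromorphic f ∧
    ¬ ∃ p q : Polynomial ℂ, q ≠ 0 ∧ f =ᶠ[codiscrete ℂ] fun z ↦ p.eval z / q.eval z

/-- The differential monomial `M[f] = a f ^ q₀ (f') ^ q₁ ⋯ (f^(k)) ^ q_k`. -/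
def monomial (a : ℂ) (k : ℕ) (q : ℕ → ℕ) (f : ℂ → ℂ) : ℂ → ℂ :=
  fun z ↦ a * ∏ i ∈ Finset.range (k + 1), (iteratedDeriv i f z) ^ q i

/-- The degree `μ = q₀ + q₁ + ⋯ + q_k`. -/
def degree (k : ℕ) (q : ℕ → ℕ) : ℕ := ∑ i ∈ Finset.range (k + 1), q i

/-- The number `μ_* = q₁ + 2 q₂ + ⋯ + k q_k`. -/
def starDegree (k : ℕ) (q : ℕ → ℕ) : ℕ := ∑ i ∈ Finset.range (k + 1), i * q i

/-- The reduced polar divisor of `g`: every pole of `g` counted exactly once. -/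
def reducedPoleDivisor (g : ℂ → ℂ) : Function.locallyFinsupp ℂ ℤ where
  toFun z := if MeromorphicOn.divisor g Set.univ z < 0 then 1 else 0
  supportWithinDomain' := Set.subset_univ _
  supportLocallyFiniteWithinDomain' := by
    intro z hz
    obtain ⟨t, ht, hfin⟩ :=
      (MeromorphicOn.divisor g Set.univ).supportLocallyFiniteWithinDomain z hz
    refine ⟨t, ht, hfin.subset ?_⟩
    rintro w ⟨hwt, hw⟩
    refine ⟨hwt, ?_⟩
    intro h0
    exact hw (if_neg (by rw [h0]; exact lt_irrefl 0))

/-- The reduced (Nevanlinna) counting function `N̄(r, g)` of the poles of `g`, each counted once: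
the sum of `log (r / |z|)` over the poles `z ≠ 0` in `|z| ≤ r`, plus `log r` if `0` is a pole. -/
def reducedLogCounting (g : ℂ → ℂ) : ℝ → ℝ :=
  Function.locallyFinsuppWithin.logCounting (reducedPoleDivisor g)

/-- `S` is a quantity of type `S(r, f)`: `S(r) = o(T(r, f))` as `r → ∞` outside some set of
positive reals of finite Lebesgue measure. -/
def IsSmallRemainder (S : ℝ → ℝ) (f : ℂ → ℂ) : Prop :=
  ∃ E : Set ℝ, E ⊆ Set.Ioi 0 ∧ MeasurableSet E ∧ MeasureTheory.volume E < ⊤ ∧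
    S =o[atTop ⊓ 𝓟 Eᶜ] ValueDistribution.characteristic f ⊤

end

end DiffMonomial

/-!
Let `μ` and `μ_*` be the degree and the weight of the monomial `M = M[f]`, and put
`G = M' / (M - 1)`, the logarithmic derivative of `M - 1`. The inequality comes from the identity
`1 / M = 1 - (M' / M) / G`.

The lemma on the logarithmic derivative (`isBigO_proximity_logDeriv`) makes `m(r, M' / M)`,
`m(r, G)` and all `m(r, f^(i) / f)` of size `O(log r + log⁺ T(r, f))` off a set of finite measure.
The identity then bounds `m(r, 1 / M)` by `m(r, 1 / G)`, which Jensen's formula turns into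
`-N(r, 0, G) + N(r, ∞, G)` up to small terms, and `f ^ (-μ)` is `1 / M` times a product of powers of
the `f^(i) / f`; hence `μ m(r, 1 / f)` is at most the logarithmic counting function of `-div G`.
Adding `μ N(r, 1 / f)` gives a bound for `μ T(r, f)` by the counting function of the divisor
`μ (f)₀ - div G`. A comparison of orders at each point (`divisor_estimate`) shows that this
divisor is at most `(f)_∞ + (μ_* + 1) (f)₀` plus the reduced divisor of the zeros of `M - 1`, and the
first two terms contribute no more than `(μ_* + 2) T(r, f)`. This is `exists_mul_characteristic_le`.
That `M` is not constant is proved along the same lines: otherwise `f` has no zeros and `m(r, 1 / f)`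
is small.

The error terms are `o(T(r, f))` because a meromorphic function whose characteristic is not of larger
order than `log r` is rational (`exists_polynomial_div_of_frequently`). The same fact shows that
`M / c` takes the value `1` infinitely often: otherwise the reduced counting function is `O(log r)`.

The lemma on the logarithmic derivative itself rests on two ingredients. After division by the zeros
and poles in a disc, the logarithmic derivative of the remaining zero-free factor is bounded by a
differentiated Poisson integral (`norm_logDeriv_le_circleAverage`); the partial fractions split off
in this way have a small mean on circles because `‖z - a‖ ^ (-1 / 2)` is integrable there
(`circleAverage_le_of_le_posLog_sum_inv`). Borel's growth lemma (`eventually_lt_two_mul`) then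
removes the auxiliary radii.
-/

namespace DiffMonomial

open Metric Real MeasureTheory Set ValueDistribution MeromorphicOn Asymptotics

/-! ### Logarithmic derivatives of zero-free functions -/

/-- A differentiated Schwarz formula: on a disc, the derivative of a holomorphic function is an
integral of its real part over the boundary circle. -/
lemma deriv_eq_circleAverage_re {h : ℂ → ℂ} {ρ R : ℝ} (hR : 0 < R) (hρ : R < ρ)
    (hh : DifferentiableOn ℂ h (ball 0 ρ)) {z : ℂ} (hz : z ∈ ball (0 : ℂ) R) :
    deriv h z = circleAverage (fun ζ ↦ ((2 * (h ζ).re : ℝ) : ℂ) * (ζ / (ζ - z) ^ 2)) 0 R := by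
  have hsub : closedBall (0 : ℂ) R ⊆ ball 0 ρ := closedBall_subset_ball hρ
  have hz' : ‖z‖ < R := by simpa using hz
  have hne : ∀ ζ ∈ sphere (0 : ℂ) R, ζ - z ≠ 0 := by
    intro ζ hζ h0
    rw [sub_eq_zero] at h0
    simp only [mem_sphere_iff_norm, sub_zero] at hζ
    rw [h0] at hζ
    exact hz'.ne hζ
  have hcont : ContinuousOn h (sphere 0 R) :=
    hh.continuousOn.mono (sphere_subset_closedBall.trans hsub)
  have hker : ContinuousOn (fun ζ : ℂ ↦ ζ / (ζ - z) ^ 2) (sphere 0 R) :=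
    continuousOn_id.div (by fun_prop) fun ζ hζ ↦ pow_ne_zero _ (hne ζ hζ)
  have hA : circleAverage (fun ζ ↦ h ζ * (ζ / (ζ - z) ^ 2)) 0 R = deriv h z := by
    rw [← Complex.two_pi_I_inv_smul_circleIntegral_sub_sq_inv_smul_of_differentiable isOpen_ball
      hsub hh hz, circleAverage_eq_circleIntegral hR.ne']
    congr 1
    refine circleIntegral.integral_congr hR.le fun ζ hζ ↦ ?_
    have hζ0 : ζ ≠ 0 := ne_of_mem_sphere hζ hR.ne'
    have := hne ζ hζ
    simp only [smul_eq_mul, sub_zero]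
    field_simp
  -- The conjugate of the kernel extends holomorphically to the disc, with a zero at the centre.
  have hB : circleAverage (fun ζ ↦ (starRingEnd ℂ) (h ζ) * (ζ / (ζ - z) ^ 2)) 0 R = 0 := by
    have hden : ∀ ζ ∈ closedBall (0 : ℂ) R, (R : ℂ) ^ 2 - (starRingEnd ℂ) z * ζ ≠ 0 := by
      intro ζ hζ h0
      have hζ' : ‖ζ‖ ≤ R := by simpa using hζ
      have h1 : ‖(R : ℂ) ^ 2‖ = ‖(starRingEnd ℂ) z * ζ‖ := by rw [sub_eq_zero.1 h0]
      rw [norm_mul, RCLike.norm_conj, norm_pow, Complex.norm_real, Real.norm_of_nonneg hR.le] at h1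
      nlinarith [norm_nonneg z, norm_nonneg ζ]
    have h1 : circleAverage (fun ζ ↦ h ζ * ((R : ℂ) ^ 2 * ζ / ((R : ℂ) ^ 2 -
        (starRingEnd ℂ) z * ζ) ^ 2)) 0 R = 0 := by
      have hd : DiffContOnCl ℂ (fun ζ ↦ h ζ * ((R : ℂ) ^ 2 * ζ / ((R : ℂ) ^ 2 -
          (starRingEnd ℂ) z * ζ) ^ 2)) (ball 0 |R|) := by
        rw [abs_of_pos hR]
        apply DifferentiableOn.diffContOnCl
        rw [closure_ball _ hR.ne']
        refine (hh.mono hsub).mul (DifferentiableOn.div (by fun_prop) (by fun_prop) ?_)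
        exact fun ζ hζ ↦ pow_ne_zero _ (hden ζ hζ)
      simpa using hd.circleAverage
    have hci : CircleIntegrable (fun ζ ↦ h ζ * ((R : ℂ) ^ 2 * ζ / ((R : ℂ) ^ 2 -
        (starRingEnd ℂ) z * ζ) ^ 2)) 0 R := by
      refine ContinuousOn.circleIntegrable hR.le (hcont.mul (ContinuousOn.div (by fun_prop)
        (by fun_prop) ?_))
      exact fun ζ hζ ↦ pow_ne_zero _ (hden ζ (sphere_subset_closedBall hζ))
    have h2 := ContinuousLinearMap.circleAverage_comp_comm (E := ℂ) (F := ℂ)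
      (Complex.conjCLE.toContinuousLinearMap : ℂ →L[ℝ] ℂ) hci
    rw [h1, map_zero] at h2
    refine Eq.trans ?_ h2
    refine circleAverage_congr_sphere fun ζ hζ ↦ ?_
    rw [abs_of_pos hR] at hζ
    have hζ0 : ζ ≠ 0 := ne_of_mem_sphere hζ hR.ne'
    have hζR : ζ * (starRingEnd ℂ) ζ = (R : ℂ) ^ 2 := by
      rw [Complex.mul_conj']
      simp only [mem_sphere_iff_norm, sub_zero] at hζ
      rw [hζ]
    have hc0 : (starRingEnd ℂ) ζ ≠ 0 := (map_ne_zero _).2 hζ0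
    have h3 := hne ζ hζ
    simp only [Function.comp_apply, ContinuousLinearEquiv.coe_coe, Complex.conjCLE_apply, map_mul,
      map_div₀, map_pow, map_sub, Complex.conj_ofReal, Complex.conj_conj]
    congr 1
    rw [← hζR]
    have h4 : ζ * (starRingEnd ℂ) ζ - z * (starRingEnd ℂ) ζ = (ζ - z) * (starRingEnd ℂ) ζ := by ring
    rw [h4]
    field_simp
  have hconj : ContinuousOn (fun ζ ↦ (starRingEnd ℂ) (h ζ)) (sphere 0 R) :=
    Complex.continuous_conj.comp_continuousOn hcont
  have hadd := circleAverage_fun_add ((hcont.mul hker).circleIntegrable hR.le)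
    ((hconj.mul hker).circleIntegrable hR.le)
  simp only [Pi.mul_apply] at hadd
  calc deriv h z = circleAverage (fun ζ ↦ h ζ * (ζ / (ζ - z) ^ 2)
        + (starRingEnd ℂ) (h ζ) * (ζ / (ζ - z) ^ 2)) 0 R := by
        refine Eq.trans ?_ hadd.symm
        exact (by rw [hA, hB, add_zero] : deriv h z =
          circleAverage (fun ζ ↦ h ζ * (ζ / (ζ - z) ^ 2)) 0 R
          + circleAverage (fun ζ ↦ (starRingEnd ℂ) (h ζ) * (ζ / (ζ - z) ^ 2)) 0 R)
    _ = _ := by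
        congr 1
        ext ζ
        rw [← add_mul, Complex.add_conj]

/-- For a zero-free analytic function `g`, the logarithmic derivative inside a disc is controlled by
the mean of `|log ‖g‖|` over the boundary circle. -/
theorem norm_logDeriv_le_circleAverage {g : ℂ → ℂ} {R : ℝ} (hR : 0 < R)
    (hg : AnalyticOnNhd ℂ g (closedBall 0 R)) (hg0 : ∀ z ∈ closedBall (0 : ℂ) R, g z ≠ 0)
    {z : ℂ} (hz : z ∈ ball (0 : ℂ) R) :
    ‖logDeriv g z‖ ≤ 2 * R / (R - ‖z‖) ^ 2 * circleAverage (fun ζ ↦ |log ‖g ζ‖|) 0 R := by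
  have hz' : ‖z‖ < R := by simpa using hz
  have hopen : IsOpen {w : ℂ | AnalyticAt ℂ g w ∧ g w ≠ 0} := by
    rw [isOpen_iff_mem_nhds]
    rintro w ⟨h1, h2⟩
    exact h1.eventually_analyticAt.and (h1.continuousAt.eventually_ne h2)
  obtain ⟨δ, hδ, hthick⟩ := (isCompact_closedBall (0 : ℂ) R).exists_thickening_subset_open hopen
    (fun w hw ↦ ⟨hg w hw, hg0 w hw⟩)
  rw [thickening_closedBall hδ hR.le] at hthick
  have hρ : R < δ + R := by linarith
  have hgd : DifferentiableOn ℂ g (ball 0 (δ + R)) := fun w hw ↦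
    (hthick hw).1.differentiableAt.differentiableWithinAt
  have hL : DifferentiableOn ℂ (logDeriv g) (ball 0 (δ + R)) := fun w hw ↦
    ((hthick hw).1.deriv.div (hthick hw).1 (hthick hw).2).differentiableAt.differentiableWithinAt
  obtain ⟨h, hh⟩ := hL.isExactOn_ball
  have hhd : DifferentiableOn ℂ h (ball 0 (δ + R)) := fun w hw ↦
    (hh w hw).differentiableAt.differentiableWithinAt
  -- `g * exp (-h)` has vanishing derivative, so it is a constant.
  have hconst : ∀ w ∈ ball (0 : ℂ) (δ + R), g w * Complex.exp (-h w) =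
      g 0 * Complex.exp (-h 0) := by
    intro w hw
    refine (isOpen_ball.is_const_of_deriv_eq_zero (convex_ball _ _).isPreconnected
      (f := fun w ↦ g w * Complex.exp (-h w)) ?_ ?_ hw (mem_ball_self (by linarith)))
    · exact hgd.mul hhd.neg.cexp
    · intro w hw
      have h1 := (hthick hw).1.differentiableAt.hasDerivAt.mul (hh w hw).neg.cexp
      refine h1.deriv.trans ?_
      have := (hthick hw).2
      simp only [logDeriv_apply, Pi.zero_apply, Pi.neg_apply]
      field_simp
      ring
  set c : ℝ := log ‖g 0 * Complex.exp (-h 0)‖ with hc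
  have hlog : ∀ w ∈ ball (0 : ℂ) (δ + R), (h w + c).re = log ‖g w‖ := by
    intro w hw
    have h1 := congrArg (fun x ↦ log ‖x‖) (hconst w hw)
    rw [norm_mul, Complex.norm_exp, log_mul (norm_ne_zero_iff.2 (hthick hw).2) (exp_pos _).ne',
      log_exp, Complex.neg_re, ← hc] at h1
    rw [Complex.add_re, Complex.ofReal_re]
    linarith
  have hzb : z ∈ ball (0 : ℂ) (δ + R) := ball_subset_ball hρ.le hz
  have hder : deriv (fun w ↦ h w + c) z = logDeriv g z := by
    rw [deriv_add_const, (hh z hzb).deriv]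
  rw [← hder, deriv_eq_circleAverage_re hR hρ (hhd.add_const _) hz]
  have hcont : ContinuousOn (fun ζ ↦ |log ‖g ζ‖|) (sphere 0 R) := by
    refine ContinuousOn.abs (ContinuousOn.log ?_ ?_)
    · exact (hgd.continuousOn.mono (sphere_subset_closedBall.trans (closedBall_subset_ball hρ))).norm
    · exact fun ζ hζ ↦ norm_ne_zero_iff.2 (hg0 ζ (sphere_subset_closedBall hζ))
  calc ‖circleAverage (fun ζ ↦ ((2 * (h ζ + c).re : ℝ) : ℂ) * (ζ / (ζ - z) ^ 2)) 0 R‖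
      ≤ circleAverage (fun ζ ↦ 2 * R / (R - ‖z‖) ^ 2 * |log ‖g ζ‖|) 0 R := by
        rw [circleAverage_def, circleAverage_def, norm_smul, smul_eq_mul,
          Real.norm_of_nonneg (by positivity)]
        gcongr
        refine intervalIntegral.norm_integral_le_of_norm_le two_pi_pos.le ?_ ?_
        · filter_upwards with θ _
          have hmem : circleMap 0 R θ ∈ sphere (0 : ℂ) R := circleMap_mem_sphere 0 hR.le θ
          have hmb : circleMap 0 R θ ∈ ball (0 : ℂ) (δ + R) :=
            closedBall_subset_ball hρ (sphere_subset_closedBall hmem)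
          have hn : ‖circleMap 0 R θ‖ = R := by simpa using hmem
          have h2 : R - ‖z‖ ≤ ‖circleMap 0 R θ - z‖ := by
            have := norm_sub_norm_le (circleMap 0 R θ) z
            linarith
          rw [hlog _ hmb, norm_mul, Complex.norm_real, norm_div, norm_pow, hn, norm_mul,
            Real.norm_eq_abs, Real.norm_eq_abs, abs_two]
          have h3 : 0 < R - ‖z‖ := by linarith
          calc 2 * |log ‖g (circleMap 0 R θ)‖| * (R / ‖circleMap 0 R θ - z‖ ^ 2)
              ≤ 2 * |log ‖g (circleMap 0 R θ)‖| * (R / (R - ‖z‖) ^ 2) := by gcongr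
            _ = _ := by ring
        · exact (continuousOn_const.mul hcont).circleIntegrable hR.le
    _ = _ := by
        exact circleAverage_fun_smul (a := 2 * R / (R - ‖z‖) ^ 2) (E := ℝ)

/-! ### Circle means of sums of reciprocal distances -/

lemma intervalIntegrable_sqrt_inv_abs_sin (a b : ℝ) :
    IntervalIntegrable (fun θ : ℝ ↦ √|sin θ|⁻¹) volume a b := by
  have hmeas : Measurable (fun θ : ℝ ↦ √|sin θ|⁻¹) := by fun_prop
  have h1 : IntervalIntegrable (fun θ : ℝ ↦ √|sin θ|⁻¹) volume 0 (π / 2) := by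
    have h2 : IntervalIntegrable (fun θ : ℝ ↦ √(2 / π)⁻¹ * θ ^ (-(1 / 2) : ℝ)) volume 0 (π / 2) :=
      (intervalIntegral.intervalIntegrable_rpow' (by norm_num)).const_mul _
    refine h2.mono_fun hmeas.aestronglyMeasurable ?_
    rw [uIoc_of_le (by positivity)]
    filter_upwards [ae_restrict_mem measurableSet_Ioc] with θ hθ
    have h3 : 2 / π * θ ≤ sin θ := mul_le_sin hθ.1.le hθ.2
    have h4 : 0 < 2 / π * θ := mul_pos (by positivity) hθ.1
    rw [Real.norm_of_nonneg (sqrt_nonneg _), abs_of_pos (h4.trans_le h3)]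
    refine le_trans (sqrt_le_sqrt (inv_anti₀ h4 h3)) (le_trans (le_of_eq ?_) (le_abs_self _))
    rw [mul_inv, sqrt_mul (by positivity), rpow_neg hθ.1.le, ← sqrt_eq_rpow, sqrt_inv θ]
  have h2 : IntervalIntegrable (fun θ : ℝ ↦ √|sin θ|⁻¹) volume (π / 2) π := by
    have := (h1.comp_sub_left π).symm
    simp only [sin_pi_sub, sub_zero] at this
    convert this using 1
    ring
  have hper : Function.Periodic (fun θ : ℝ ↦ √|sin θ|⁻¹) π := by
    intro θ
    simp [sin_add_pi]
  exact hper.intervalIntegrable₀ pi_pos.ne' (h1.trans h2) a b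

/-- The mean value of `|sin θ| ^ (-1 / 2)` over a period. -/
noncomputable def sinMean : ℝ := (2 * π)⁻¹ * ∫ θ in 0..2 * π, √|sin θ|⁻¹

lemma sinMean_nonneg : 0 ≤ sinMean :=
  mul_nonneg (by positivity) (intervalIntegral.integral_nonneg two_pi_pos.le
    fun _ _ ↦ sqrt_nonneg _)

lemma intervalIntegrable_sqrt_inv_abs_sin_sub (α : ℝ) :
    IntervalIntegrable (fun θ : ℝ ↦ √|sin (θ - α)|⁻¹) volume 0 (2 * π) := by
  have := (intervalIntegrable_sqrt_inv_abs_sin (0 - α) (2 * π - α)).comp_sub_right α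
  simpa using this

lemma integral_sqrt_inv_abs_sin_sub (α : ℝ) :
    (2 * π)⁻¹ * ∫ θ in 0..2 * π, √|sin (θ - α)|⁻¹ = sinMean := by
  rw [intervalIntegral.integral_comp_sub_right (fun θ ↦ √|sin θ|⁻¹)]
  have hper : Function.Periodic (fun θ : ℝ ↦ √|sin θ|⁻¹) (2 * π) := by
    intro θ
    simp [sin_add_two_pi]
  have := hper.intervalIntegral_add_eq (0 - α) 0
  rw [zero_add] at this
  rw [sinMean, ← this]
  congr 3
  ring

/-- The distance from a point of a circle to `a` is at least its distance to the line through `a`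
and the centre. -/
lemma mul_abs_sin_le_norm_circleMap_sub {r : ℝ} (hr : 0 ≤ r) (a : ℂ) (θ : ℝ) :
    r * |sin (θ - a.arg)| ≤ ‖circleMap 0 r θ - a‖ := by
  have h1 : circleMap 0 r θ - a =
      Complex.exp (a.arg * Complex.I) * (circleMap 0 r (θ - a.arg) - ‖a‖) := by
    nth_rw 1 [← Complex.norm_mul_exp_arg_mul_I a]
    rw [circleMap_zero, circleMap_zero, mul_sub, mul_left_comm, ← Complex.exp_add]
    push_cast
    ring_nf
  rw [h1, norm_mul, Complex.norm_exp_ofReal_mul_I, one_mul]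
  refine le_trans (le_of_eq ?_) (Complex.abs_im_le_norm _)
  rw [circleMap_zero, Complex.sub_im, Complex.ofReal_im, sub_zero]
  rw [Complex.im_ofReal_mul, Complex.exp_ofReal_mul_I_im, abs_mul, abs_of_nonneg hr]

lemma sqrt_sum_mul_le {ι : Type*} (s : Finset ι) {d x : ι → ℝ} (hd : ∀ i ∈ s, 1 ≤ d i)
    (hx : ∀ i ∈ s, 0 ≤ x i) : √(∑ i ∈ s, d i * x i) ≤ ∑ i ∈ s, d i * √(x i) := by
  refine sqrt_le_iff.2 ⟨Finset.sum_nonneg fun i hi ↦ mul_nonneg (zero_le_one.trans (hd i hi))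
    (sqrt_nonneg _), ?_⟩
  refine le_trans (Finset.sum_le_sum fun i hi ↦ ?_) (Finset.sum_sq_le_sq_sum_of_nonneg (fun i hi ↦
    mul_nonneg (zero_le_one.trans (hd i hi)) (sqrt_nonneg (x i))))
  rw [mul_pow, sq_sqrt (hx i hi)]
  have := hd i hi
  exact mul_le_mul_of_nonneg_right (by nlinarith) (hx i hi)

/-- If `F` is bounded on a circle by `K + log⁺ (∑ d a / ‖z - a‖)`, then its mean exceeds `K` by no
more than the logarithm of the total weight, up to constants: this follows from
`log (1 + y) ≤ log m + y / m` and from the integrability of `‖z - a‖ ^ (-1 / 2)`. -/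
lemma circleAverage_le_of_le_posLog_sum_inv {F : ℂ → ℝ} {r K : ℝ} (hr : 1 ≤ r)
    (hF : CircleIntegrable F 0 r) (s : Finset ℂ) {d : ℂ → ℝ} (hd : ∀ a ∈ s, 1 ≤ d a)
    (h : ∀ᶠ z in codiscreteWithin (sphere (0 : ℂ) |r|),
      F z ≤ K + log⁺ (∑ a ∈ s, d a * ‖z - a‖⁻¹)) :
    circleAverage F 0 r ≤ K + 2 * log (∑ a ∈ s, d a + 1) + 2 * sinMean := by
  set n := ∑ a ∈ s, d a with hn
  have hd0 : ∀ a ∈ s, 0 ≤ d a := fun a ha ↦ zero_le_one.trans (hd a ha)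
  have hn0 : 0 ≤ n := Finset.sum_nonneg hd0
  have hr0 : r ≠ 0 := by linarith
  set G : ℝ → ℝ := fun θ ↦ (K + 2 * log (n + 1)) +
    2 / (n + 1) * ∑ a ∈ s, d a * √|sin (θ - a.arg)|⁻¹ with hG
  have hsumint : IntervalIntegrable (fun θ : ℝ ↦ ∑ a ∈ s, d a * √|sin (θ - a.arg)|⁻¹) volume
      0 (2 * π) := by
    have := IntervalIntegrable.sum (μ := volume) (a := 0) (b := 2 * π) s
      (f := fun (a : ℂ) (θ : ℝ) ↦ d a * √|sin (θ - a.arg)|⁻¹)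
      (fun a _ ↦ (intervalIntegrable_sqrt_inv_abs_sin_sub a.arg).const_mul (d a))
    simpa [Finset.sum_fn] using this
  have hGint : IntervalIntegrable G volume 0 (2 * π) :=
    intervalIntegrable_const.add (hsumint.const_mul _)
  have hGval : (2 * π)⁻¹ * ∫ θ in 0..2 * π, G θ =
      K + 2 * log (n + 1) + 2 / (n + 1) * (n * sinMean) := by
    rw [hG, intervalIntegral.integral_add intervalIntegrable_const (hsumint.const_mul _),
      intervalIntegral.integral_const, intervalIntegral.integral_const_mul,
      intervalIntegral.integral_finsetSum
        (fun a _ ↦ (intervalIntegrable_sqrt_inv_abs_sin_sub a.arg).const_mul (d a))]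
    have hterm : ∀ a ∈ s, (∫ θ in 0..2 * π, d a * √|sin (θ - a.arg)|⁻¹) =
        2 * π * (d a * sinMean) := by
      intro a _
      rw [intervalIntegral.integral_const_mul, ← integral_sqrt_inv_abs_sin_sub a.arg]
      field_simp
    rw [Finset.sum_congr rfl hterm, ← Finset.mul_sum, ← Finset.sum_mul, ← hn, smul_eq_mul]
    field_simp
    ring
  have hle : circleAverage F 0 r ≤ (2 * π)⁻¹ * ∫ θ in 0..2 * π, G θ := by
    rw [circleAverage_def, smul_eq_mul]
    refine mul_le_mul_of_nonneg_left ?_ (by positivity)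
    refine intervalIntegral.integral_mono_ae_restrict two_pi_pos.le hF hGint ?_
    have h1 : ∀ᵐ θ ∂volume.restrict (Icc 0 (2 * π)),
        F (circleMap 0 r θ) ≤ K + log⁺ (∑ a ∈ s, d a * ‖circleMap 0 r θ - a‖⁻¹) := by
      refine ae_restrict_le_codiscreteWithin measurableSet_Icc ?_
      exact codiscreteWithin_mono (by tauto) (circleMap_preimage_codiscrete (c := 0) hr0 h)
    have h2 : ∀ᵐ θ ∂(volume : Measure ℝ), ∀ a ∈ s, sin (θ - a.arg) ≠ 0 := by
      refine (Filter.eventually_all_finset s).2 ?_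
      intro a _
      have hc : {θ : ℝ | sin (θ - a.arg) = 0}.Countable := by
        refine (countable_range fun m : ℤ ↦ m * π + a.arg).mono ?_
        intro θ hθ
        obtain ⟨m, hm⟩ := Real.sin_eq_zero_iff.1 hθ
        exact ⟨m, by simp [hm]⟩
      exact hc.ae_notMem volume
    filter_upwards [h1, ae_restrict_of_ae h2] with θ hθ1 hθ2
    refine hθ1.trans ?_
    set X := ∑ a ∈ s, d a * ‖circleMap 0 r θ - a‖⁻¹ with hX
    set Y := ∑ a ∈ s, d a * √|sin (θ - a.arg)|⁻¹ with hY
    have hX0 : 0 ≤ X := Finset.sum_nonneg fun a ha ↦ mul_nonneg (hd0 a ha) (by positivity)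
    have hY0 : 0 ≤ Y := Finset.sum_nonneg fun a ha ↦ mul_nonneg (hd0 a ha) (by positivity)
    have hXY : √X ≤ Y := by
      refine (sqrt_sum_mul_le s hd fun a _ ↦ by positivity).trans
        (Finset.sum_le_sum fun a ha ↦ mul_le_mul_of_nonneg_left (sqrt_le_sqrt ?_) (hd0 a ha))
      have h3 := mul_abs_sin_le_norm_circleMap_sub (zero_le_one.trans hr) a θ
      have h4 : 0 < |sin (θ - a.arg)| := abs_pos.2 (hθ2 a ha)
      exact inv_anti₀ h4 (le_trans (le_mul_of_one_le_left h4.le hr) h3)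
    have h5 : log⁺ X ≤ 2 * log (1 + Y) := by
      have : log⁺ X = 2 * log⁺ (√X) := by
        conv_lhs => rw [← sq_sqrt hX0]
        simp
      rw [this, posLog_eq_log_max_one (sqrt_nonneg X)]
      gcongr
      exact max_le (by linarith) (by linarith)
    have h6 : log (1 + Y) ≤ log (n + 1) + 1 / (n + 1) * Y := by
      have h7 : log ((1 + Y) / (n + 1)) ≤ (1 + Y) / (n + 1) - 1 :=
        log_le_sub_one_of_pos (by positivity)
      rw [log_div (by positivity) (by positivity)] at h7
      have h8 : (1 + Y) / (n + 1) - 1 ≤ 1 / (n + 1) * Y := by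
        rw [add_div]
        have : 1 / (n + 1) ≤ 1 := by rw [div_le_one (by positivity)]; linarith
        have : Y / (n + 1) = 1 / (n + 1) * Y := by ring
        linarith
      linarith
    have h9 : G θ = K + 2 * (log (n + 1) + 1 / (n + 1) * Y) := by
      rw [hG, hY]
      ring
    rw [h9]
    linarith
  rw [hGval] at hle
  have h10 : 2 / (n + 1) * (n * sinMean) ≤ 2 * sinMean := by
    have h11 : 2 / (n + 1) * n ≤ 2 := by
      rw [div_mul_eq_mul_div, div_le_iff₀ (by positivity)]
      linarith
    calc 2 / (n + 1) * (n * sinMean) = 2 / (n + 1) * n * sinMean := by ring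
      _ ≤ _ := mul_le_mul_of_nonneg_right h11 sinMean_nonneg
  linarith

section

/-! ### The logarithmic derivative of a meromorphic function on a circle -/

lemma abs_log_eq_two_mul_posLog_sub_log (x : ℝ) : |log x| = 2 * log⁺ x - log x := by
  rw [posLog_apply]
  rcases le_total 0 (log x) with h | h
  · rw [max_eq_right h, abs_of_nonneg h]
    ring
  · rw [max_eq_left h, abs_of_nonpos h]
    ring

lemma abs_log_eq_posLog_add_posLog_inv (x : ℝ) : |log x| = log⁺ x + log⁺ x⁻¹ := by
  rw [abs_log_eq_two_mul_posLog_sub_log, ← posLog_sub_posLog_inv]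
  ring

lemma circleAverage_abs_log_norm_sub_le {a : ℂ} {R : ℝ} (hR : 1 ≤ R) (ha : ‖a‖ ≤ R) :
    circleAverage (fun z ↦ |log ‖z - a‖|) 0 R ≤ log R + 2 * log 2 := by
  have hR0 : 0 < R := by linarith
  have hci : CircleIntegrable (fun z ↦ log ‖z - a‖) 0 R := circleIntegrable_log_norm_sub_const R
  have h1 : circleAverage (fun z ↦ |log ‖z - a‖|) 0 R ≤
      circleAverage (fun z ↦ 2 * log (2 * R) - log ‖z - a‖) 0 R := by
    refine circleAverage_mono hci.abs ((circleIntegrable_const _ _ _).sub hci) fun z hz ↦ ?_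
    have hz' : ‖z‖ = R := by simpa [abs_of_pos hR0] using hz
    rw [abs_log_eq_two_mul_posLog_sub_log]
    have h2 : log⁺ ‖z - a‖ ≤ log (2 * R) := by
      rw [posLog_eq_log_max_one (norm_nonneg _)]
      refine log_le_log (by positivity) (max_le (by linarith) ?_)
      have := norm_sub_le z a
      linarith
    linarith
  rw [circleAverage_fun_sub (circleIntegrable_const _ _ _) hci, circleAverage_const,
    circleAverage_log_norm_sub_const_of_mem_closedBall (by simpa [abs_of_pos hR0] using ha),
    log_mul two_ne_zero hR0.ne'] at h1
  linarith

lemma circleAverage_abs_log_norm_eq {f : ℂ → ℂ} (hf : Meromorphic f) (R : ℝ) :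
    circleAverage (fun z ↦ |log ‖f z‖|) 0 R = proximity f ⊤ R + proximity f⁻¹ ⊤ R := by
  rw [proximity_top, proximity_top, ← circleAverage_fun_add
    hf.meromorphicOn.circleIntegrable_posLog_norm hf.inv.meromorphicOn.circleIntegrable_posLog_norm]
  congr 1
  ext z
  rw [abs_log_eq_posLog_add_posLog_inv, Pi.inv_apply, norm_inv]

/-- The zero-free factor left over after dividing out zeros and poles: its mean modulus of logarithm
over a circle is controlled by the proximity functions and by the number of zeros and poles. -/
lemma circleAverage_abs_log_norm_le_of_factorization {f g : ℂ → ℂ} (hf : Meromorphic f) {R : ℝ}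
    (hR : 1 ≤ R) (s : Finset ℂ) (d : ℂ → ℤ) (hs : ∀ a ∈ s, ‖a‖ ≤ R)
    (h : ∀ᶠ z in codiscreteWithin (sphere (0 : ℂ) |R|),
      log ‖f z‖ = ∑ a ∈ s, d a * log ‖z - a‖ + log ‖g z‖) :
    circleAverage (fun z ↦ |log ‖g z‖|) 0 R ≤ proximity f ⊤ R + proximity f⁻¹ ⊤ R +
      (∑ a ∈ s, |(d a : ℝ)|) * (log R + 2 * log 2) := by
  have hR0 : R ≠ 0 := by linarith
  have hfi : CircleIntegrable (fun z ↦ log ‖f z‖) 0 R := hf.meromorphicOn.circleIntegrable_log_norm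
  have hfa : CircleIntegrable (fun z ↦ |log ‖f z‖|) 0 R := hfi.abs
  have hai : ∀ a : ℂ, CircleIntegrable (fun z ↦ log ‖z - a‖) 0 R :=
    fun a ↦ circleIntegrable_log_norm_sub_const R
  have hsi : CircleIntegrable (fun z ↦ ∑ a ∈ s, d a * log ‖z - a‖) 0 R := by
    have := CircleIntegrable.sum (c := 0) (R := R) s (f := fun a z ↦ (d a : ℝ) * log ‖z - a‖)
      fun a _ ↦ IntervalIntegrable.const_mul (hai a) _
    simpa [Finset.sum_fn] using this
  have hsi' : ∀ a ∈ s, CircleIntegrable (fun z ↦ |(d a : ℝ)| * |log ‖z - a‖|) 0 R :=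
    fun a _ ↦ IntervalIntegrable.const_mul (hai a).abs _
  have hsi'' : CircleIntegrable (fun z ↦ ∑ a ∈ s, |(d a : ℝ)| * |log ‖z - a‖|) 0 R := by
    have := CircleIntegrable.sum (c := 0) (R := R) s
      (f := fun a z ↦ |(d a : ℝ)| * |log ‖z - a‖|) hsi'
    simpa [Finset.sum_fn] using this
  have hcongr : circleAverage (fun z ↦ |log ‖g z‖|) 0 R =
      circleAverage (fun z ↦ |log ‖f z‖ - ∑ a ∈ s, d a * log ‖z - a‖|) 0 R := by
    refine circleAverage_congr_codiscreteWithin ?_ hR0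
    filter_upwards [h] with z hz
    rw [hz]
    ring_nf
  rw [hcongr, ← circleAverage_abs_log_norm_eq hf R]
  calc circleAverage (fun z ↦ |log ‖f z‖ - ∑ a ∈ s, d a * log ‖z - a‖|) 0 R
      ≤ circleAverage (fun z ↦ |log ‖f z‖| + ∑ a ∈ s, |(d a : ℝ)| * |log ‖z - a‖|) 0 R := by
        refine circleAverage_mono (hfi.sub hsi).abs (hfa.add hsi'') fun z _ ↦ ?_
        refine (abs_sub _ _).trans ?_
        gcongr
        refine (Finset.abs_sum_le_sum_abs _ _).trans (le_of_eq ?_)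
        simp_rw [abs_mul]
    _ = circleAverage (fun z ↦ |log ‖f z‖|) 0 R +
          ∑ a ∈ s, |(d a : ℝ)| * circleAverage (fun z ↦ |log ‖z - a‖|) 0 R := by
        rw [circleAverage_fun_add hfa hsi'', circleAverage_fun_sum hsi']
        congr 1
        refine Finset.sum_congr rfl fun a _ ↦ ?_
        exact circleAverage_fun_smul (a := |(d a : ℝ)|) (E := ℝ)
    _ ≤ _ := by
        rw [Finset.sum_mul]
        gcongr with a ha
        exact circleAverage_abs_log_norm_sub_le hR (hs a ha)

variable {f : ℂ → ℂ}

/-- The points of the closed disc of radius `R` where the divisor of `f` does not vanish. -/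
noncomputable def divisorPoints (f : ℂ → ℂ) (R : ℝ) : Finset ℂ :=
  ((divisor f (closedBall (0 : ℂ) R)).finiteSupport (isCompact_closedBall 0 R)).toFinset

/-- The number of zeros and poles of `f` in the closed disc of radius `R`, with multiplicity. -/
noncomputable def divisorCount (f : ℂ → ℂ) (R : ℝ) : ℝ :=
  ∑ a ∈ divisorPoints f R, |(divisor f univ a : ℝ)|

lemma divisorCount_nonneg (f : ℂ → ℂ) (R : ℝ) : 0 ≤ divisorCount f R :=
  Finset.sum_nonneg fun _ _ ↦ abs_nonneg _

lemma norm_le_of_mem_divisorPoints {R : ℝ} {a : ℂ} (ha : a ∈ divisorPoints f R) : ‖a‖ ≤ R := by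
  have h1 : a ∈ (divisor f (closedBall (0 : ℂ) R)).support := by simpa [divisorPoints] using ha
  simpa using (divisor f (closedBall (0 : ℂ) R)).supportWithinDomain h1

lemma divisor_closedBall_eq (hf : Meromorphic f) {R : ℝ} {a : ℂ} (ha : a ∈ divisorPoints f R) :
    divisor f (closedBall (0 : ℂ) R) a = divisor f univ a := by
  rw [divisor_apply hf.meromorphicOn (by simpa using norm_le_of_mem_divisorPoints ha),
    divisor_apply hf.meromorphicOn (mem_univ a)]

lemma one_le_abs_divisor (hf : Meromorphic f) {R : ℝ} {a : ℂ} (ha : a ∈ divisorPoints f R) :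
    (1 : ℝ) ≤ |(divisor f univ a : ℝ)| := by
  have h1 : divisor f (closedBall (0 : ℂ) R) a ≠ 0 := by simpa [divisorPoints] using ha
  rw [divisor_closedBall_eq hf ha] at h1
  exact_mod_cast Int.one_le_abs h1

/-- Dividing `f` by its zeros and poles in a disc and applying the estimate for zero-free functions
to the quotient bounds the logarithmic derivative inside the disc. -/
theorem norm_logDeriv_le (hf : Meromorphic f) (hf' : ∀ z, meromorphicOrderAt f z ≠ ⊤) {R : ℝ}
    (hR : 1 ≤ R) :
    ∀ᶠ z in codiscreteWithin (ball (0 : ℂ) R), ‖logDeriv f z‖ ≤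
      2 * R / (R - ‖z‖) ^ 2 * (proximity f ⊤ R + proximity f⁻¹ ⊤ R +
        divisorCount f R * (log R + 2 * log 2)) +
      ∑ a ∈ divisorPoints f R, |(divisor f univ a : ℝ)| * ‖z - a‖⁻¹ := by
  have hR0 : 0 < R := by linarith
  set D := divisor f (closedBall (0 : ℂ) R) with hD
  have hfin : D.support.Finite := D.finiteSupport (isCompact_closedBall 0 R)
  obtain ⟨g, hga, hg0, hfg⟩ := hf.meromorphicOn.extract_zeros_poles
    (fun u : closedBall (0 : ℂ) R ↦ hf' u) hfin
  have hlog := MeromorphicOn.extract_zeros_poles_log hg0 hfg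
  have hsupp : ∀ x : ℂ → ℝ, ∑ᶠ a, (D a : ℝ) * x a = ∑ a ∈ divisorPoints f R, (D a : ℝ) * x a := by
    intro x
    refine finsum_eq_sum_of_support_subset _ fun a ha ↦ ?_
    simp only [divisorPoints, Finite.coe_toFinset, Function.mem_support]
    intro h0
    exact ha (by simp [hD, h0])
  have havg : circleAverage (fun z ↦ |log ‖g z‖|) 0 R ≤ proximity f ⊤ R + proximity f⁻¹ ⊤ R +
      divisorCount f R * (log R + 2 * log 2) := by
    have := circleAverage_abs_log_norm_le_of_factorization (g := g) hf hR (divisorPoints f R) D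
      (fun a ha ↦ norm_le_of_mem_divisorPoints ha) ?_
    · refine this.trans (le_of_eq ?_)
      rw [divisorCount]
      congr 2
      exact Finset.sum_congr rfl fun a ha ↦ by rw [divisor_closedBall_eq hf ha]
    · rw [abs_of_pos hR0]
      refine Filter.codiscreteWithin_mono sphere_subset_closedBall ?_
      filter_upwards [hlog] with z hz
      rw [hz, Pi.add_apply]
      congr 1
      rw [← hsupp (fun a ↦ log ‖z - a‖)]
      have hfs : (Function.support fun u : ℂ ↦ (fun x : ℂ ↦ (D u : ℝ) * log ‖x - u‖)).Finite := by
        refine hfin.subset fun a ha h0 ↦ ha ?_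
        ext x
        simp [h0]
      exact finsum_apply hfs z
  have hfg' : f =ᶠ[codiscreteWithin (ball (0 : ℂ) R)] (∏ᶠ u, (· - u) ^ D u) • g :=
    hfg.filter_mono (Filter.codiscreteWithin_mono ball_subset_closedBall)
  have hgb : AnalyticOnNhd ℂ g (ball 0 R) := hga.mono ball_subset_closedBall
  have h1 := logDeriv_congr_codiscreteWithin isOpen_ball hfg'
  have hP : Meromorphic (∏ᶠ u, (· - u) ^ D u : ℂ → ℂ) := by
    refine Meromorphic.finprod fun u z ↦ ?_
    fun_prop
  have h2 := MeromorphicOn.logDeriv_mul_eventuallyEq (U := ball (0 : ℂ) R)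
    (hP.meromorphicOn) hgb.meromorphicOn
    (fun x _ ↦ Function.FactorizedRational.meromorphicOrderAt_ne_top _)
    (fun x hx ↦ by
      have hx' := ball_subset_closedBall hx
      rw [(hga x hx').meromorphicOrderAt_eq,
        (hga x hx').analyticOrderAt_eq_zero.2 (hg0 ⟨x, hx'⟩)]
      simp)
  have h3 := MeromorphicOn.logDeriv_finprod_zpow_eventuallyEq (U := ball (0 : ℂ) R)
    (F := fun (u : ℂ) (x : ℂ) ↦ x - u) (d := D) hfin (fun i ↦ by
      have : Meromorphic fun x : ℂ ↦ x - i := fun x ↦ by fun_prop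
      exact this.meromorphicOn)
    (fun i x _ ↦ by
      have han : AnalyticAt ℂ (fun x : ℂ ↦ x - i) x := by fun_prop
      rw [meromorphicOrderAt_ne_top_iff_eventually_ne_zero han.meromorphicAt]
      rcases eq_or_ne x i with rfl | hx
      · filter_upwards [self_mem_nhdsWithin] with y hy
        exact sub_ne_zero.2 hy
      · exact (han.continuousAt.eventually_ne (sub_ne_zero.2 hx)).filter_mono nhdsWithin_le_nhds)
  filter_upwards [h1, h2, h3, self_mem_codiscreteWithin (ball (0 : ℂ) R)] with z hz1 hz2 hz3 hzb
  rw [hz1, smul_eq_mul, hz2, Pi.add_apply, hz3, add_comm]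
  refine (norm_add_le _ _).trans (add_le_add ?_ ?_)
  · refine (norm_logDeriv_le_circleAverage hR0 hga (fun w hw ↦ hg0 ⟨w, hw⟩) hzb).trans ?_
    gcongr
  · have h4 : ∑ᶠ i, D i • logDeriv (fun x : ℂ ↦ x - i) z =
        ∑ a ∈ divisorPoints f R, D a • (1 / (z - a)) := by
      rw [finsum_eq_sum_of_support_subset (s := divisorPoints f R)]
      · refine Finset.sum_congr rfl fun a _ ↦ ?_
        simp [logDeriv_apply]
      · intro a ha
        simp only [divisorPoints, Finite.coe_toFinset, Function.mem_support]
        intro h0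
        exact ha (by simp [hD, h0])
    rw [h4]
    refine (norm_sum_le _ _).trans (Finset.sum_le_sum fun a ha ↦ ?_)
    rw [← divisor_closedBall_eq hf ha, zsmul_eq_mul, norm_mul, norm_div, norm_one, one_div,
      Complex.norm_intCast]

end

section

/-! ### Growth outside exceptional sets of finite measure -/

/-- Neighbourhoods of `+∞` with a set of finite Lebesgue measure removed. -/
noncomputable def atTopOffFinite : Filter ℝ := atTop ⊓ (volume : Measure ℝ).cofinite

lemma atTopOffFinite_le_atTop : atTopOffFinite ≤ atTop := inf_le_left

instance neBot_atTopOffFinite : atTopOffFinite.NeBot := by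
  refine inf_neBot_iff.2 fun {s} hs {t} ht ↦ ?_
  obtain ⟨a, ha⟩ := mem_atTop_sets.1 hs
  by_contra hemp
  have hsub : Ici a ⊆ tᶜ := fun x hx hxt ↦ hemp ⟨x, ha x hx, hxt⟩
  have := (measure_mono hsub).trans_lt (Measure.mem_cofinite.1 ht)
  simp at this

/-- Borel's growth lemma. On the set where `2 ^ n ≤ U < 2 ^ (n + 1)` and `U` at least doubles over
a step of length `1 / U`, any two points have distance at most `2 ^ (-n)`. -/
theorem eventually_lt_two_mul {U : ℝ → ℝ} (hU : MonotoneOn U (Ioi 0)) (h1 : ∀ r, 1 ≤ r → 1 ≤ U r) :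
    ∀ᶠ r in atTopOffFinite, U (r + 1 / U r) < 2 * U r := by
  set E : Set ℝ := {r | 1 ≤ r ∧ 2 * U r ≤ U (r + 1 / U r)} with hE
  have hvol : volume E < ⊤ := by
    set F : ℕ → Set ℝ := fun n ↦ {r ∈ E | 2 ^ n ≤ U r ∧ U r < 2 ^ (n + 1)} with hF
    have hcover : E ⊆ ⋃ n, F n := by
      intro r hr
      obtain ⟨n, hn⟩ := exists_nat_pow_near (h1 r hr.1) one_lt_two
      exact mem_iUnion.2 ⟨n, hr, hn⟩
    have hstep : ∀ n, ∀ x ∈ F n, ∀ y ∈ F n, x ≤ y → y - x ≤ (1 / 2) ^ n := by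
      rintro n x ⟨⟨hx1, hx2⟩, hx3, hx4⟩ y ⟨⟨hy1, hy2⟩, hy3, hy4⟩ hxy
      by_contra! hlt
      have hpos : 0 < U x := by linarith [h1 x hx1]
      have h2 : 1 / U x ≤ (1 / 2) ^ n := by
        rw [one_div_pow]
        exact one_div_le_one_div_of_le (by positivity) hx3
      have h3 : U (x + 1 / U x) ≤ U y :=
        hU (mem_Ioi.2 (by positivity)) (mem_Ioi.2 (by linarith)) (by linarith)
      rw [pow_succ] at hy4
      linarith
    have hdiam : ∀ n, volume (F n) ≤ (2⁻¹ : ENNReal) ^ n := by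
      intro n
      refine (Real.volume_le_diam _).trans (Metric.ediam_le fun x hx y hy ↦ ?_)
      have h2 : (2⁻¹ : ENNReal) ^ n = ENNReal.ofReal ((1 / 2) ^ n) := by
        rw [ENNReal.ofReal_pow (by norm_num), one_div, ENNReal.ofReal_inv_of_pos two_pos]
        simp
      rw [h2, edist_dist]
      refine ENNReal.ofReal_le_ofReal ?_
      rw [Real.dist_eq]
      rcases le_total x y with h | h
      · rw [abs_sub_comm, abs_of_nonneg (by linarith)]
        exact hstep n x hx y hy h
      · rw [abs_of_nonneg (by linarith)]
        exact hstep n y hy x hx h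
    calc volume E ≤ volume (⋃ n, F n) := measure_mono hcover
      _ ≤ ∑' n, volume (F n) := measure_iUnion_le _
      _ ≤ ∑' n, (2⁻¹ : ENNReal) ^ n := ENNReal.tsum_le_tsum hdiam
      _ < ⊤ := by
        rw [ENNReal.tsum_geometric]
        simp
  have h2 : ∀ᶠ r in atTopOffFinite, r ∉ E :=
    (inf_le_right : atTopOffFinite ≤ _) (Measure.compl_mem_cofinite.2 hvol)
  filter_upwards [h2, atTopOffFinite_le_atTop (eventually_ge_atTop 1)] with r hr hr1
  by_contra! h3
  exact hr ⟨hr1, h3⟩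

/-! ### The lemma on the logarithmic derivative -/

lemma sum_mul_le_logCounting {D : Function.locallyFinsupp ℂ ℤ} (hD : 0 ≤ D) {R R' : ℝ}
    (hR : 1 ≤ R) (hRR' : R ≤ R') (s : Finset ℂ) (hs : ∀ a ∈ s, ‖a‖ ≤ R) :
    (∑ a ∈ s, (D a : ℝ)) * (log R' - log R) ≤
      Function.locallyFinsuppWithin.logCounting D R' := by
  classical
  have hle : ∑ a ∈ s, Function.locallyFinsuppWithin.single a (D a) ≤ D := by
    rw [Function.locallyFinsuppWithin.le_def, Pi.le_def]
    intro w
    simp only [Function.locallyFinsuppWithin.coe_sum, Finset.sum_apply,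
      Function.locallyFinsuppWithin.single_apply, Finset.sum_ite_eq]
    split_ifs
    · exact le_rfl
    · exact hD w
  refine le_trans ?_ (Function.locallyFinsuppWithin.logCounting_le hle (hR.trans hRR'))
  rw [map_sum, Finset.sum_apply, Finset.sum_mul]
  refine Finset.sum_le_sum fun a ha ↦ ?_
  rw [Function.locallyFinsuppWithin.logCounting_single_eq_log_sub_const ((hs a ha).trans hRR')]
  refine mul_le_mul_of_nonneg_left ?_ (by exact_mod_cast hD a)
  have : log ‖a‖ ≤ log R := by
    rcases eq_or_ne a 0 with rfl | h0
    · simpa using log_nonneg hR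
    · exact log_le_log (norm_pos_iff.2 h0) (hs a ha)
  linarith

variable {f : ℂ → ℂ}

lemma divisorCount_mul_le (f : ℂ → ℂ) {R R' : ℝ} (hR : 1 ≤ R) (hRR' : R ≤ R') :
    divisorCount f R * (log R' - log R) ≤ logCounting f ⊤ R' + logCounting f⁻¹ ⊤ R' := by
  have h1 := sum_mul_le_logCounting (negPart_nonneg (divisor f univ)) hR hRR' (divisorPoints f R)
    fun a ha ↦ norm_le_of_mem_divisorPoints ha
  have h2 := sum_mul_le_logCounting (posPart_nonneg (divisor f univ)) hR hRR' (divisorPoints f R)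
    fun a ha ↦ norm_le_of_mem_divisorPoints ha
  rw [logCounting_inv, logCounting_top, logCounting_zero]
  refine le_trans (le_of_eq ?_) (add_le_add h1 h2)
  rw [← add_mul, ← Finset.sum_add_distrib, divisorCount]
  congr 1
  refine Finset.sum_congr rfl fun a _ ↦ ?_
  rw [Function.locallyFinsuppWithin.negPart_apply, Function.locallyFinsuppWithin.posPart_apply]
  rw [add_comm, ← Int.cast_add, posPart_add_negPart, Int.cast_abs]

lemma characteristic_inv_le (hf : Meromorphic f) {r : ℝ} (hr : r ≠ 0) :
    characteristic f⁻¹ ⊤ r ≤ characteristic f ⊤ r + |log ‖meromorphicTrailingCoeffAt f 0‖| := by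
  have h1 := characteristic_sub_characteristic_inv_of_ne_zero hf hr
  have h2 := neg_abs_le (log ‖meromorphicTrailingCoeffAt f 0‖)
  linarith

/-- The estimate behind the lemma on the logarithmic derivative, with two free radii. -/
lemma proximity_logDeriv_le (hf : Meromorphic f) (hf' : ∀ z, meromorphicOrderAt f z ≠ ⊤) {r R : ℝ}
    (hr : 1 ≤ r) (hrR : r < R) :
    proximity (logDeriv f) ⊤ r ≤
      log⁺ (2 * R / (R - r) ^ 2 * (proximity f ⊤ R + proximity f⁻¹ ⊤ R +
        divisorCount f R * (log R + 2 * log 2))) + log 2 +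
      2 * log (divisorCount f R + 1) + 2 * sinMean := by
  have hr0 : 0 < r := by linarith
  rw [proximity_top, add_comm (log⁺ _) (log 2)]
  refine circleAverage_le_of_le_posLog_sum_inv hr
    (hf.logDeriv.meromorphicOn.circleIntegrable_posLog_norm) (divisorPoints f R)
    (d := fun a ↦ |(divisor f univ a : ℝ)|) (fun a ha ↦ one_le_abs_divisor hf ha) ?_
  have hsub : sphere (0 : ℂ) |r| ⊆ ball 0 R := by
    rw [abs_of_pos hr0]
    exact sphere_subset_ball hrR
  filter_upwards [Filter.codiscreteWithin_mono hsub (norm_logDeriv_le hf hf' (hr.trans hrR.le)),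
    self_mem_codiscreteWithin (sphere (0 : ℂ) |r|)] with z hz hzs
  have hzn : ‖z‖ = r := by simpa [abs_of_pos hr0] using hzs
  rw [hzn] at hz
  exact (posLog_le_posLog (norm_nonneg _) hz).trans posLog_add

lemma one_le_characteristic_add (f : ℂ → ℂ) {r : ℝ} (hr : 1 ≤ r) :
    1 ≤ characteristic f ⊤ r + (|log ‖meromorphicTrailingCoeffAt f 0‖| + 1) := by
  have := characteristic_nonneg (f := f) (a := ⊤) hr
  have := abs_nonneg (log ‖meromorphicTrailingCoeffAt f 0‖)
  linarith

/-- The **lemma on the logarithmic derivative**: outside a set of finite measure,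
`m(r, f'/f) = O(log r + log⁺ T(r, f))`. -/
theorem isBigO_proximity_logDeriv (hf : Meromorphic f) (hf' : ∀ z, meromorphicOrderAt f z ≠ ⊤) :
    proximity (logDeriv f) ⊤ =O[atTopOffFinite]
      fun r ↦ log r + log⁺ (characteristic f ⊤ r) := by
  set c := |log ‖meromorphicTrailingCoeffAt f 0‖| with hc
  have hc0 : 0 ≤ c := abs_nonneg _
  set U : ℝ → ℝ := fun r ↦ characteristic f ⊤ r + (c + 1) with hUdef
  have hUmono : MonotoneOn U (Ioi 0) := (characteristic_monotoneOn hf).add_const _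
  have hU1 : ∀ r, 1 ≤ r → 1 ≤ U r := fun r hr ↦ one_le_characteristic_add f hr
  have hsumle : ∀ R, 1 ≤ R → proximity f ⊤ R + proximity f⁻¹ ⊤ R +
      (logCounting f ⊤ R + logCounting f⁻¹ ⊤ R) ≤ 2 * U R := by
    intro R hR
    have h1 := characteristic_inv_le hf (r := R) (by linarith)
    simp only [characteristic, Pi.add_apply, hUdef] at h1 ⊢
    linarith
  set K : ℝ := log 1088 + log 2 + 2 * log 17 + 2 * sinMean + 8 * (log 2 + log⁺ (c + 1)) + 8 with hK
  have hK8 : 8 ≤ K := by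
    have := log_nonneg (show (1 : ℝ) ≤ 1088 by norm_num)
    have := log_nonneg (show (1 : ℝ) ≤ 2 by norm_num)
    have := log_nonneg (show (1 : ℝ) ≤ 17 by norm_num)
    have := posLog_nonneg (x := c + 1)
    have := sinMean_nonneg
    linarith
  refine Asymptotics.IsBigO.of_bound K ?_
  filter_upwards [eventually_lt_two_mul hUmono hU1,
    atTopOffFinite_le_atTop (eventually_ge_atTop (exp 1))] with r hborel hre
  have hr : 1 ≤ r := (one_le_exp zero_le_one).trans hre
  have hr0 : 0 < r := by linarith
  have hlogr : 1 ≤ log r := by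
    rw [← log_exp 1]
    exact log_le_log (exp_pos 1) hre
  set u := U r with hu
  have hu1 : 1 ≤ u := hU1 r hr
  have hu0 : 0 < u := by linarith
  -- The pointwise estimate is used on the disc of radius `R`, and the number of zeros and poles in
  -- that disc is bounded by the counting functions at `R'`.
  set R := r + 1 / (2 * u) with hRdef
  set R' := r + 1 / u with hR'def
  have hinv : 1 / u = 2 * (1 / (2 * u)) := by field_simp
  have hpos : 0 < 1 / (2 * u) := by positivity
  have hinv1 : 1 / u ≤ 1 := by rw [div_le_one hu0]; exact hu1
  have hrR : r < R := by linarith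
  have hRR' : R < R' := by linarith
  have hR1 : 1 ≤ R := by linarith
  have hR2 : R ≤ 2 * r := by linarith
  have hR'2 : R' ≤ 2 * r := by linarith
  have hUR' : U R' ≤ 2 * u := hborel.le
  have hUR : U R ≤ 2 * u :=
    (hUmono (mem_Ioi.2 (by linarith)) (mem_Ioi.2 (by linarith)) hRR'.le).trans hUR'
  set n := divisorCount f R with hn
  have hn0 : 0 ≤ n := divisorCount_nonneg f R
  have hnle : n ≤ 16 * u ^ 2 * r := by
    have h1 := divisorCount_mul_le f hR1 hRR'.le
    have h2 := hsumle R' (by linarith)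
    have h3 := proximity_nonneg (f := f) (a := ⊤) R'
    have h4 := proximity_nonneg (f := f⁻¹) (a := ⊤) R'
    simp only [Pi.zero_apply] at h3 h4
    have h5 : 1 / (4 * u * r) ≤ log R' - log R := by
      have h6 := one_sub_inv_le_log_of_pos (show 0 < R' / R by positivity)
      rw [log_div (by positivity) (by positivity), inv_div] at h6
      refine le_trans ?_ h6
      have h7 : 1 - R / R' = (1 / (2 * u)) / R' := by
        have : R' ≠ 0 := by linarith
        rw [one_sub_div this]
        congr 1
        linarith
      rw [h7, div_div]
      refine one_div_le_one_div_of_le (by positivity) ?_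
      calc 2 * u * R' ≤ 2 * u * (2 * r) := by gcongr
        _ = _ := by ring
    have h8 : n * (1 / (4 * u * r)) ≤ 4 * u := by
      calc n * (1 / (4 * u * r)) ≤ n * (log R' - log R) := by gcongr
        _ ≤ 4 * u := by linarith
    rw [mul_one_div, div_le_iff₀ (by positivity)] at h8
    linarith
  have hA : 2 * R / (R - r) ^ 2 * (proximity f ⊤ R + proximity f⁻¹ ⊤ R +
      n * (log R + 2 * log 2)) ≤ 1088 * r ^ 3 * u ^ 4 := by
    have h1 : proximity f ⊤ R + proximity f⁻¹ ⊤ R ≤ 4 * u := by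
      have h2 := hsumle R hR1
      have h3 := logCounting_nonneg (f := f) (e := ⊤) hR1
      have h4 := logCounting_nonneg (f := f⁻¹) (e := ⊤) hR1
      linarith
    have h2 : log R + 2 * log 2 ≤ 4 * r := by
      have h3 := log_le_sub_one_of_pos (show 0 < R by linarith)
      have h4 := log_le_sub_one_of_pos (show (0 : ℝ) < 2 by norm_num)
      linarith
    have h2' : 0 ≤ log R + 2 * log 2 := by
      have := log_nonneg hR1
      have := log_nonneg (show (1 : ℝ) ≤ 2 by norm_num)
      linarith
    have h3 : 2 * R / (R - r) ^ 2 ≤ 16 * r * u ^ 2 := by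
      have : R - r = 1 / (2 * u) := by rw [hRdef]; ring
      rw [this]
      have h4 : 2 * R / (1 / (2 * u)) ^ 2 = 8 * R * u ^ 2 := by
        field_simp
        ring
      rw [h4]
      calc 8 * R * u ^ 2 ≤ 8 * (2 * r) * u ^ 2 := by gcongr
        _ = _ := by ring
    have h5 : u ≤ u ^ 2 * r ^ 2 := by
      have : 1 ≤ u * r ^ 2 := one_le_mul_of_one_le_of_one_le hu1 (one_le_pow₀ hr)
      nlinarith
    have h6 : proximity f ⊤ R + proximity f⁻¹ ⊤ R + n * (log R + 2 * log 2) ≤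
        68 * (u ^ 2 * r ^ 2) := by
      calc proximity f ⊤ R + proximity f⁻¹ ⊤ R + n * (log R + 2 * log 2)
          ≤ 4 * u + (16 * u ^ 2 * r) * (4 * r) := by gcongr
        _ ≤ 4 * (u ^ 2 * r ^ 2) + (16 * u ^ 2 * r) * (4 * r) := by gcongr
        _ = _ := by ring
    calc _ ≤ 16 * r * u ^ 2 * (68 * (u ^ 2 * r ^ 2)) := by
          refine mul_le_mul h3 h6 ?_ (by positivity)
          have h7 := proximity_nonneg (f := f) (a := ⊤) R
          have h8 := proximity_nonneg (f := f⁻¹) (a := ⊤) R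
          simp only [Pi.zero_apply] at h7 h8
          positivity
      _ = _ := by ring
  have hlogu0 : 0 ≤ log u := log_nonneg hu1
  have hA2 : log⁺ (2 * R / (R - r) ^ 2 * (proximity f ⊤ R + proximity f⁻¹ ⊤ R +
      n * (log R + 2 * log 2))) ≤ log 1088 + 3 * log r + 4 * log u := by
    rw [posLog_apply]
    have hexp : log (1088 * r ^ 3 * u ^ 4) = log 1088 + 3 * log r + 4 * log u := by
      rw [log_mul (by positivity) (by positivity), log_mul (by positivity) (by positivity),
        log_pow, log_pow]
      push_cast
      ring
    have h1 : (0 : ℝ) ≤ log 1088 := log_nonneg (by norm_num)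
    refine max_le (by linarith) ?_
    rw [← hexp]
    rcases le_or_gt (2 * R / (R - r) ^ 2 * (proximity f ⊤ R + proximity f⁻¹ ⊤ R +
      n * (log R + 2 * log 2))) 0 with h0 | h0
    · have h7 := proximity_nonneg (f := f) (a := ⊤) R
      have h8 := proximity_nonneg (f := f⁻¹) (a := ⊤) R
      simp only [Pi.zero_apply] at h7 h8
      have h9 : 0 ≤ 2 * R / (R - r) ^ 2 * (proximity f ⊤ R + proximity f⁻¹ ⊤ R +
          n * (log R + 2 * log 2)) := by
        have := log_nonneg hR1
        have := log_nonneg (show (1 : ℝ) ≤ 2 by norm_num)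
        positivity
      rw [le_antisymm h0 h9, log_zero]
      linarith
    · exact log_le_log h0 hA
  have hlogn : log (n + 1) ≤ log 17 + log r + 2 * log u := by
    have hexp : log (17 * u ^ 2 * r) = log 17 + log r + 2 * log u := by
      rw [log_mul (by positivity) (by positivity), log_mul (by positivity) (by positivity), log_pow]
      push_cast
      ring
    rw [← hexp]
    refine log_le_log (by positivity) ?_
    have : 1 ≤ u ^ 2 * r := one_le_mul_of_one_le_of_one_le (one_le_pow₀ hu1) hr
    linarith
  have hlogu : log u ≤ log 2 + log⁺ (characteristic f ⊤ r) + log⁺ (c + 1) := by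
    refine le_trans ?_ posLog_add
    rw [posLog_apply]
    exact le_max_right _ _
  have hmain := proximity_logDeriv_le hf hf' hr hrR
  have hp0 := proximity_nonneg (f := logDeriv f) (a := ⊤) r
  have hpos' := posLog_nonneg (x := characteristic f ⊤ r)
  rw [Real.norm_of_nonneg hp0, Real.norm_of_nonneg (by linarith)]
  have hfin : proximity (logDeriv f) ⊤ r ≤
      (K - 8) * 1 + 8 * (log r + log⁺ (characteristic f ⊤ r)) := by
    rw [hK]
    linarith
  calc proximity (logDeriv f) ⊤ r ≤ (K - 8) * 1 + 8 * (log r + log⁺ (characteristic f ⊤ r)) := hfin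
    _ ≤ (K - 8) * (log r + log⁺ (characteristic f ⊤ r)) +
        8 * (log r + log⁺ (characteristic f ⊤ r)) := by
      gcongr
      linarith
    _ = _ := by ring

end

section

variable {f : ℂ → ℂ}

/-! ### Growth of transcendental functions -/

lemma zpow_eq_toNat_div (x : ℂ) (n : ℤ) : x ^ n = x ^ n.toNat / x ^ (-n).toNat := by
  rcases le_total 0 n with h | h
  · rw [Int.toNat_of_nonpos (by omega : -n ≤ 0), pow_zero, div_one, ← zpow_natCast,
      Int.toNat_of_nonneg h]
  · rw [Int.toNat_of_nonpos h, pow_zero, one_div, ← zpow_natCast,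
      Int.toNat_of_nonneg (by omega : 0 ≤ -n), zpow_neg, inv_inv]

/-- If `T(r, f) ≤ C log r` for arbitrarily large `r`, then the number of zeros and poles of `f` in
any disc is at most `2 C`. -/
lemma divisorCount_le_of_frequently (hf : Meromorphic f) {C : ℝ}
    (h : ∃ᶠ r in atTop, characteristic f ⊤ r < C * log r) {R : ℝ} (hR : 1 ≤ R) :
    divisorCount f R ≤ 2 * C := by
  by_contra! hlt
  set c := |log ‖meromorphicTrailingCoeffAt f 0‖|
  have ht : Tendsto (fun r ↦ (divisorCount f R - 2 * C) * log r) atTop atTop :=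
    tendsto_log_atTop.const_mul_atTop (sub_pos.2 hlt)
  obtain ⟨r, hr, hr1, hr2⟩ := (h.and_eventually ((eventually_ge_atTop R).and
    (ht.eventually_gt_atTop (c + divisorCount f R * log R)))).exists
  have hr1' : 1 ≤ r := hR.trans hr1
  have h1 := divisorCount_mul_le f hR hr1
  have h2 := characteristic_inv_le hf (r := r) (by linarith)
  have h3 := proximity_nonneg (f := f) (a := ⊤) r
  have h4 := proximity_nonneg (f := f⁻¹) (a := ⊤) r
  simp only [characteristic, Pi.add_apply, Pi.zero_apply] at *
  linarith

lemma finite_support_divisor_of_frequently (hf : Meromorphic f) {C : ℝ}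
    (h : ∃ᶠ r in atTop, characteristic f ⊤ r < C * log r) :
    (divisor f univ).support.Finite := by
  by_contra hinf
  obtain ⟨N, hN⟩ := exists_nat_gt (2 * C)
  obtain ⟨t, hts, htc⟩ := Set.Infinite.exists_subset_card_eq hinf N
  obtain ⟨R₀, hR₀⟩ : ∃ R₀ : ℝ, ∀ z ∈ t, ‖z‖ ≤ R₀ := t.finite_toSet.isBounded.exists_norm_le
  set R := max 1 R₀
  have hR : 1 ≤ R := le_max_left _ _
  have hsub : t ⊆ divisorPoints f R := by
    intro a ha
    have h1 : ‖a‖ ≤ R := (hR₀ a ha).trans (le_max_right _ _)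
    have h2 : divisor f univ a ≠ 0 := hts ha
    have h3 : divisor f (closedBall (0 : ℂ) R) a ≠ 0 := by
      rw [divisor_apply hf.meromorphicOn (by simpa using h1)]
      rwa [divisor_apply hf.meromorphicOn (mem_univ a)] at h2
    simpa [divisorPoints] using h3
  have h4 : (N : ℝ) ≤ divisorCount f R := by
    calc (N : ℝ) = ∑ a ∈ t, (1 : ℝ) := by simp [htc]
      _ ≤ ∑ a ∈ t, |(divisor f univ a : ℝ)| :=
        Finset.sum_le_sum fun a ha ↦ one_le_abs_divisor hf (hsub ha)
      _ ≤ divisorCount f R :=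
        Finset.sum_le_sum_of_subset_of_nonneg hsub fun _ _ _ ↦ abs_nonneg _
  linarith [divisorCount_le_of_frequently hf h hR]

/-- A meromorphic function whose characteristic is bounded by a multiple of `log r` for arbitrarily
large `r` is rational: it has finitely many zeros and poles, and the zero-free factor remaining after
these are divided out has vanishing logarithmic derivative. -/
theorem exists_polynomial_div_of_frequently (hf : Meromorphic f)
    (hf' : ∀ z, meromorphicOrderAt f z ≠ ⊤) {C : ℝ}
    (h : ∃ᶠ r in atTop, characteristic f ⊤ r < C * log r) :
    ∃ p q : Polynomial ℂ, q ≠ 0 ∧ f =ᶠ[codiscrete ℂ] fun z ↦ p.eval z / q.eval z := by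
  set D := divisor f univ with hD
  have hfin : D.support.Finite := finite_support_divisor_of_frequently hf h
  obtain ⟨g, hga, hg0, hfg⟩ := (hf.meromorphicOn (s := univ)).extract_zeros_poles
    (fun u : (univ : Set ℂ) ↦ hf' u) hfin
  have hg0' : ∀ z, g z ≠ 0 := fun z ↦ hg0 ⟨z, mem_univ z⟩
  have hlog := MeromorphicOn.extract_zeros_poles_log hg0 hfg
  set s := hfin.toFinset with hs
  set n : ℝ := ∑ a ∈ s, |(D a : ℝ)| with hn
  set c := |log ‖meromorphicTrailingCoeffAt f 0‖| with hc
  obtain ⟨R₀, hR₀⟩ : ∃ R₀ : ℝ, ∀ z ∈ s, ‖z‖ ≤ R₀ := s.finite_toSet.isBounded.exists_norm_le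
  have hbound : ∃ᶠ R in atTop, circleAverage (fun z ↦ |log ‖g z‖|) 0 R ≤
      (2 * C + n) * log R + (c + n * (2 * log 2)) := by
    refine (h.and_eventually ((eventually_ge_atTop 1).and (eventually_ge_atTop R₀))).mono ?_
    rintro R ⟨hR, hR1, hR2⟩
    have h1 := circleAverage_abs_log_norm_le_of_factorization (g := g) hf hR1 s D
      (fun a ha ↦ (hR₀ a ha).trans hR2) ?_
    · have h2 := characteristic_inv_le hf (r := R) (by linarith)
      have h3 := logCounting_nonneg (f := f) (e := ⊤) hR1
      have h4 := logCounting_nonneg (f := f⁻¹) (e := ⊤) hR1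
      simp only [characteristic, Pi.add_apply] at *
      linarith
    · refine Filter.codiscreteWithin_mono (subset_univ _) ?_
      filter_upwards [hlog] with z hz
      rw [hz, Pi.add_apply]
      congr 1
      have hfs : (Function.support fun u : ℂ ↦ (fun x : ℂ ↦ (D u : ℝ) * log ‖x - u‖)).Finite := by
        refine hfin.subset fun a ha h0 ↦ ha ?_
        ext x
        simp [h0]
      refine (finsum_apply hfs z).trans (finsum_eq_sum_of_support_subset _ fun a ha ↦ ?_)
      simp only [hs, Finite.coe_toFinset, Function.mem_support]
      intro h0
      exact ha (by simp [h0])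
  have hlogDeriv : ∀ z, logDeriv g z = 0 := by
    intro z
    have hlim : Tendsto (fun R ↦ 2 * R / (R - ‖z‖) ^ 2 *
        ((2 * C + n) * log R + (c + n * (2 * log 2)))) atTop (𝓝 0) := by
      have h1 : (fun R : ℝ ↦ R - ‖z‖) ~[atTop] fun R ↦ R :=
        Asymptotics.IsEquivalent.refl.sub_isLittleO (Asymptotics.isLittleO_const_id_atTop _)
      have h2 : (fun R : ℝ ↦ 2 * R / (R - ‖z‖) ^ 2) =O[atTop] fun R ↦ R⁻¹ := by
        have h3 : (fun R : ℝ ↦ 2 * R / (R - ‖z‖) ^ 2) =O[atTop] fun R ↦ 2 * R / R ^ 2 :=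
          ((IsEquivalent.refl (u := fun R : ℝ ↦ 2 * R)).div (h1.pow 2)).isBigO
        refine h3.trans ((isBigO_const_mul_self 2 _ _).congr' ?_ EventuallyEq.rfl)
        filter_upwards [eventually_gt_atTop 0] with R hR
        field_simp
      have h4 : (fun R : ℝ ↦ (2 * C + n) * log R + (c + n * (2 * log 2))) =o[atTop] fun R ↦ R :=
        (isLittleO_log_id_atTop.const_mul_left _).add (Asymptotics.isLittleO_const_id_atTop _)
      have h5 := h2.mul_isLittleO h4
      refine (Asymptotics.isLittleO_one_iff ℝ).1 (h5.congr' EventuallyEq.rfl ?_)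
      filter_upwards [eventually_gt_atTop 0] with R hR
      field_simp
    by_contra hne
    have hpos : 0 < ‖logDeriv g z‖ := norm_pos_iff.2 hne
    obtain ⟨R, hR, hR1, hR2, hR3⟩ := (hbound.and_eventually ((eventually_gt_atTop ‖z‖).and
      ((eventually_gt_atTop 0).and (hlim.eventually_lt_const hpos)))).exists
    have h1 := norm_logDeriv_le_circleAverage hR2 (hga.mono (subset_univ _))
      (fun w _ ↦ hg0' w) (z := z) (by simpa using hR1)
    have h2 : 2 * R / (R - ‖z‖) ^ 2 * circleAverage (fun ζ ↦ |log ‖g ζ‖|) 0 R ≤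
        2 * R / (R - ‖z‖) ^ 2 * ((2 * C + n) * log R + (c + n * (2 * log 2))) := by
      gcongr
    linarith
  have hgd : Differentiable ℂ g := fun z ↦ (hga z (mem_univ z)).differentiableAt
  have hgconst : ∀ z, g z = g 0 := by
    intro z
    refine is_const_of_deriv_eq_zero hgd (fun w ↦ ?_) z 0
    have := hlogDeriv w
    rw [logDeriv_apply, div_eq_zero_iff] at this
    exact this.resolve_right (hg0' w)
  refine ⟨Polynomial.C (g 0) * ∏ a ∈ s, (Polynomial.X - Polynomial.C a) ^ (D a).toNat,
    ∏ a ∈ s, (Polynomial.X - Polynomial.C a) ^ (-D a).toNat, ?_, ?_⟩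
  · exact Finset.prod_ne_zero_iff.2 fun a _ ↦ pow_ne_zero _ (Polynomial.X_sub_C_ne_zero a)
  · filter_upwards [hfg] with z hz
    have hprod : (∏ᶠ u, (· - u) ^ D u : ℂ → ℂ) z = ∏ a ∈ s, (z - a) ^ D a := by
      rw [Function.FactorizedRational.finprod_eq_fun hfin]
      refine finprod_eq_prod_of_mulSupport_subset _ fun a ha ↦ ?_
      simp only [hs, Finite.coe_toFinset, Function.mem_support]
      intro h0
      exact ha (by simp [h0])
    rw [hz, smul_eq_mul, Pi.mul_apply, hprod, hgconst z]
    simp only [Polynomial.eval_mul, Polynomial.eval_C, Polynomial.eval_prod, Polynomial.eval_pow,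
      Polynomial.eval_sub, Polynomial.eval_X]
    rw [mul_div_assoc, ← Finset.prod_div_distrib, mul_comm]
    congr 1
    exact Finset.prod_congr rfl fun a _ ↦ zpow_eq_toNat_div _ _

lemma eventuallyEq_codiscrete_zero (hf : ∀ z, meromorphicOrderAt f z = ⊤) :
    f =ᶠ[codiscrete ℂ] 0 := by
  refine mem_codiscreteWithin_iff_forall_mem_nhdsNE.2 fun z _ ↦ ?_
  filter_upwards [meromorphicOrderAt_eq_top_iff.1 (hf z)] with w hw using Or.inl hw

/-- The identity theorem for meromorphic functions on the plane. -/
lemma meromorphicOrderAt_eq_top_of_exists (hf : Meromorphic f) {z₀ : ℂ}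
    (h : meromorphicOrderAt f z₀ = ⊤) (z : ℂ) : meromorphicOrderAt f z = ⊤ := by
  by_contra hne
  exact MeromorphicOn.meromorphicOrderAt_ne_top_of_isPreconnected (hf.meromorphicOn (s := univ))
    isPreconnected_univ (mem_univ z) (mem_univ z₀) hne h

namespace IsTranscendentalMeromorphic

lemma meromorphicOrderAt_ne_top (hf : IsTranscendentalMeromorphic f) (z : ℂ) :
    meromorphicOrderAt f z ≠ ⊤ := by
  intro h
  refine hf.2 ⟨0, 1, one_ne_zero, ?_⟩
  filter_upwards [eventuallyEq_codiscrete_zero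
    (meromorphicOrderAt_eq_top_of_exists hf.1 h)] with w hw
  simp [hw]

/-- The characteristic of a transcendental function grows faster than `log r`. -/
theorem log_isLittleO_characteristic (hf : IsTranscendentalMeromorphic f) :
    (fun r ↦ log r) =o[atTop] characteristic f ⊤ := by
  rw [Asymptotics.isLittleO_iff]
  intro ε hε
  by_contra hcon
  refine hf.2 (exists_polynomial_div_of_frequently hf.1 hf.meromorphicOrderAt_ne_top
    (C := ε⁻¹) ?_)
  refine ((not_eventually.1 hcon).and_eventually (eventually_ge_atTop 1)).mono ?_
  rintro r ⟨h1, h2⟩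
  rw [not_le, Real.norm_of_nonneg (log_nonneg h2)] at h1
  rw [inv_mul_eq_div, lt_div_iff₀ hε, mul_comm]
  exact (mul_le_mul_of_nonneg_left (le_abs_self _) hε.le).trans_lt h1

theorem tendsto_characteristic_atTop (hf : IsTranscendentalMeromorphic f) :
    Tendsto (characteristic f ⊤) atTop atTop := by
  have h1 : ∀ᶠ r in atTop, log r ≤ characteristic f ⊤ r := by
    filter_upwards [hf.log_isLittleO_characteristic.bound one_pos, eventually_ge_atTop 1]
      with r h1 h2
    rw [Real.norm_of_nonneg (log_nonneg h2), one_mul,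
      Real.norm_of_nonneg (characteristic_nonneg h2)] at h1
    exact h1
  exact tendsto_atTop_mono' _ h1 tendsto_log_atTop

end IsTranscendentalMeromorphic

end

section

variable {f : ℂ → ℂ}

/-! ### Orders of derivatives -/

lemma meromorphic_iteratedDeriv (hf : Meromorphic f) (i : ℕ) : Meromorphic (iteratedDeriv i f) := by
  rw [iteratedDeriv_eq_iterate]
  exact hf.iterated_deriv

/-- An analytic function with a vanishing iterated derivative is a polynomial: its Taylor series
is finite. -/
lemma exists_polynomial_eventuallyEq {g : ℂ → ℂ} {z₀ : ℂ} (hg : AnalyticAt ℂ g z₀) {i : ℕ}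
    (h : iteratedDeriv i g =ᶠ[𝓝 z₀] 0) :
    ∃ P : Polynomial ℂ, g =ᶠ[𝓝 z₀] fun z ↦ P.eval z := by
  have hzero : ∀ n, i ≤ n → iteratedDeriv n g z₀ = 0 := by
    intro n hn
    obtain ⟨j, rfl⟩ := Nat.exists_eq_add_of_le' hn
    rw [iteratedDeriv_eq_iterate, Function.iterate_add_apply, ← iteratedDeriv_eq_iterate,
      ← iteratedDeriv_eq_iterate, h.iteratedDeriv_eq j]
    simp
  refine ⟨∑ n ∈ Finset.range i, Polynomial.C (iteratedDeriv n g z₀ / n.factorial) *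
    (Polynomial.X - Polynomial.C z₀) ^ n, ?_⟩
  have hs := hg.hasFPowerSeriesAt.eventually_hasSum_sub
  filter_upwards [hs] with z hz
  have h1 := hasSum_sum_of_ne_finset_zero (s := Finset.range i)
    (f := fun n ↦ iteratedDeriv n g z₀ / n.factorial * (z - z₀) ^ n) (L := .unconditional ℕ)
    (fun n hn ↦ by
    rw [hzero n (by simpa using hn)]; simp)
  have h2 : HasSum (fun n ↦ iteratedDeriv n g z₀ / n.factorial * (z - z₀) ^ n) (g z) := by
    simpa [FormalMultilinearSeries.ofScalars_apply_eq, smul_eq_mul, mul_comm] using hz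
  rw [h2.unique h1]
  simp [Polynomial.eval_finsetSum]

lemma IsTranscendentalMeromorphic.meromorphicOrderAt_iteratedDeriv_ne_top
    (hf : IsTranscendentalMeromorphic f) (i : ℕ) (z : ℂ) :
    meromorphicOrderAt (iteratedDeriv i f) z ≠ ⊤ := by
  intro htop
  have hm := meromorphic_iteratedDeriv hf.1 i
  obtain ⟨z₀, hz₀⟩ : ∃ z₀, AnalyticAt ℂ f z₀ :=
    (hf.1 z).eventually_analyticAt.exists
  have h0 : iteratedDeriv i f =ᶠ[𝓝 z₀] 0 := by
    have h1 : AnalyticAt ℂ (iteratedDeriv i f) z₀ := by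
      rw [iteratedDeriv_eq_iterate]
      exact hz₀.iterated_deriv i
    refine (h1.continuousAt.eventuallyEq_nhds_iff_eventuallyEq_nhdsNE
      continuousAt_const).1 ?_
    exact meromorphicOrderAt_eq_top_iff.1 (meromorphicOrderAt_eq_top_of_exists hm htop z₀)
  obtain ⟨P, hP⟩ := exists_polynomial_eventuallyEq hz₀ h0
  have hPm : Meromorphic fun z ↦ f z - P.eval z := by
    intro z
    have := hf.1 z
    have h2 : AnalyticAt ℂ (fun z ↦ P.eval z) z :=
      (Differentiable.analyticAt (f := fun z ↦ P.eval z) P.differentiable z)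
    exact this.sub h2.meromorphicAt
  have h3 : meromorphicOrderAt (fun z ↦ f z - P.eval z) z₀ = ⊤ := by
    rw [meromorphicOrderAt_eq_top_iff]
    filter_upwards [hP.filter_mono nhdsWithin_le_nhds] with w hw
    rw [hw, sub_self]
  refine hf.2 ⟨P, 1, one_ne_zero, ?_⟩
  filter_upwards [eventuallyEq_codiscrete_zero (meromorphicOrderAt_eq_top_of_exists hPm h3)]
    with w hw
  simpa [sub_eq_zero] using hw

lemma meromorphicOrderAt_deriv_nonneg {g : ℂ → ℂ} {z : ℂ} (hg : MeromorphicAt g z)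
    (h : 0 ≤ meromorphicOrderAt g z) : 0 ≤ meromorphicOrderAt (deriv g) z := by
  obtain ⟨g', hg', hgg'⟩ := hg.meromorphicOrderAt_nonneg_iff.1 h
  rw [meromorphicOrderAt_congr hgg'.nhdsNE_deriv]
  exact hg'.deriv.meromorphicOrderAt_nonneg

/-- The orders of the derivatives of `f` at a point, with the recursion they satisfy. -/
lemma IsTranscendentalMeromorphic.exists_order_iteratedDeriv
    (hf : IsTranscendentalMeromorphic f) (z : ℂ) :
    ∃ m : ℕ → ℤ, (∀ i, meromorphicOrderAt (iteratedDeriv i f) z = m i) ∧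
      (∀ i, m i ≠ 0 → m (i + 1) = m i - 1) ∧ ∀ i, 0 ≤ m i → 0 ≤ m (i + 1) := by
  choose m hm using fun i ↦ WithTop.ne_top_iff_exists.1
    (hf.meromorphicOrderAt_iteratedDeriv_ne_top i z)
  replace hm : ∀ i, meromorphicOrderAt (iteratedDeriv i f) z = m i := fun i ↦ (hm i).symm
  refine ⟨m, hm, fun i hi ↦ ?_, fun i hi ↦ ?_⟩
  · have := meromorphicOrderAt_deriv_eq_sub_one (Int.cast_ne_zero.2 hi) (hm i)
    rw [← iteratedDeriv_succ, hm] at this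
    exact_mod_cast this
  · have := meromorphicOrderAt_deriv_nonneg (meromorphic_iteratedDeriv hf.1 i z)
      (by rw [hm]; exact_mod_cast hi)
    rw [← iteratedDeriv_succ, hm] at this
    exact_mod_cast this

lemma meromorphic_monomial (hf : Meromorphic f) (a : ℂ) (k : ℕ) (q : ℕ → ℕ) :
    Meromorphic (monomial a k q f) := by
  intro z
  have h : ∀ i, MeromorphicAt (iteratedDeriv i f) z := fun i ↦ meromorphic_iteratedDeriv hf i z
  unfold monomial
  exact (MeromorphicAt.const a z).mul
    (MeromorphicAt.fun_prod fun i _ ↦ (h i).fun_pow (q i))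

lemma meromorphicOrderAt_monomial (hf : Meromorphic f) {a : ℂ} (ha : a ≠ 0) (k : ℕ) (q : ℕ → ℕ)
    {z : ℂ} {m : ℕ → ℤ} (hm : ∀ i, meromorphicOrderAt (iteratedDeriv i f) z = m i) :
    meromorphicOrderAt (monomial a k q f) z =
      ((∑ i ∈ Finset.range (k + 1), (q i : ℤ) * m i : ℤ) : WithTop ℤ) := by
  have h : ∀ i, MeromorphicAt (iteratedDeriv i f) z := fun i ↦ meromorphic_iteratedDeriv hf i z
  have h1 : meromorphicOrderAt (monomial a k q f) z =
      meromorphicOrderAt (fun w ↦ ∏ i ∈ Finset.range (k + 1), (iteratedDeriv i f w) ^ q i) z :=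
    meromorphicOrderAt_mul_of_ne_zero (g := fun _ ↦ a) analyticAt_const ha
  rw [h1, meromorphicOrderAt_fun_prod fun i _ ↦ (h i).fun_pow (q i)]
  have h2 : ∀ i, meromorphicOrderAt (fun w ↦ iteratedDeriv i f w ^ q i) z =
      ((q i * m i : ℤ) : WithTop ℤ) := by
    intro i
    refine (meromorphicOrderAt_pow (h i)).trans ?_
    rw [hm]
    norm_cast
  simp_rw [h2]
  push_cast
  rfl

section OrderSequence

/-! ### Weighted sums of the orders of derivatives

The orders `m i` of `f^(i)` at a point satisfy `m (i + 1) = m i - 1` as long as `m i ≠ 0`, and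
stay nonnegative once they are. -/

variable {m : ℕ → ℤ} {k : ℕ} {q : ℕ → ℕ}

lemma sum_mul_sub_eq (k : ℕ) (q : ℕ → ℕ) (p : ℤ) :
    ∑ i ∈ Finset.range (k + 1), (q i : ℤ) * (p - i) = degree k q * p - starDegree k q := by
  simp only [degree, starDegree, Nat.cast_sum, Nat.cast_mul, Finset.sum_mul,
    ← Finset.sum_sub_distrib]
  exact Finset.sum_congr rfl fun i _ ↦ by ring

lemma sum_order_of_neg (h1 : ∀ i, m i ≠ 0 → m (i + 1) = m i - 1) (h0 : m 0 < 0) :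
    ∑ i ∈ Finset.range (k + 1), (q i : ℤ) * m i = degree k q * m 0 - starDegree k q := by
  have h : ∀ i : ℕ, m i = m 0 - i := by
    intro i
    induction i with
    | zero => simp
    | succ i ih => rw [h1 i (by omega), ih]; push_cast; ring
  rw [← sum_mul_sub_eq]
  exact Finset.sum_congr rfl fun i _ ↦ by rw [h i]

lemma order_nonneg (h2 : ∀ i, 0 ≤ m i → 0 ≤ m (i + 1)) (h0 : 0 ≤ m 0) (i : ℕ) : 0 ≤ m i := by
  induction i with
  | zero => exact h0
  | succ i ih => exact h2 i ih

lemma mul_le_sum_order (h2 : ∀ i, 0 ≤ m i → 0 ≤ m (i + 1)) (h0 : 0 ≤ m 0) :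
    (q 0 : ℤ) * m 0 ≤ ∑ i ∈ Finset.range (k + 1), (q i : ℤ) * m i :=
  Finset.single_le_sum (f := fun i ↦ (q i : ℤ) * m i)
    (fun i _ ↦ mul_nonneg (by positivity) (order_nonneg h2 h0 i)) (by simp)

lemma le_sum_order (h1 : ∀ i, m i ≠ 0 → m (i + 1) = m i - 1)
    (h2 : ∀ i, 0 ≤ m i → 0 ≤ m (i + 1)) :
    degree k q * m 0 - starDegree k q ≤ ∑ i ∈ Finset.range (k + 1), (q i : ℤ) * m i := by
  have h : ∀ i : ℕ, m 0 - i ≤ m i := by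
    intro i
    induction i with
    | zero => simp
    | succ i ih =>
      push_cast
      by_cases hi : m i = 0
      · have := h2 i hi.ge
        omega
      · rw [h1 i hi]
        omega
  rw [← sum_mul_sub_eq]
  exact Finset.sum_le_sum fun i _ ↦ mul_le_mul_of_nonneg_left (h i) (by positivity)

end OrderSequence

/-- The pointwise form of the divisor estimate. Here `p`, `m`, `s` and `g` stand for the orders at a
point of `f`, of `M`, of `M - 1` and of `M' / (M - 1)`. -/
lemma order_estimate {p m s g μ ν : ℤ} (hν : 0 ≤ ν)
    (hneg : p < 0 → m < 0) (hnonneg : 0 ≤ p → 0 ≤ m) (hpos : 0 < p → 0 < m) (hle : μ * p - ν ≤ m)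
    (hms : m < 0 → s = m) (hms' : 0 < m → s = 0) (hms0 : m = 0 → 0 ≤ s)
    (hs : s ≠ 0 → g = -1) (hs0 : s = 0 → 0 ≤ g) (hmg : 0 < m → g = m - 1) :
    μ * p⁺ - g ≤ p⁻ + (ν + 1) * p⁺ + (if 0 < s then 1 else 0) := by
  rcases lt_trichotomy p 0 with hp | rfl | hp
  · have h1 := hneg hp
    rw [posPart_eq_zero.2 hp.le, negPart_eq_neg.2 hp.le, hs (by rw [hms h1]; exact h1.ne)]
    split_ifs <;> omega
  · rw [posPart_zero, negPart_zero]
    rcases lt_trichotomy m 0 with hm | hm | hm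
    · exact absurd (hnonneg le_rfl) hm.not_ge
    · split_ifs with h
      · rw [hs h.ne']; simp
      · have := hs0 (le_antisymm (not_lt.1 h) (hms0 hm))
        simpa using this
    · rw [hmg hm, hms' hm]
      simp
      omega
  · have hm := hpos hp
    rw [posPart_of_nonneg hp.le, negPart_eq_zero.2 hp.le, hmg hm, hms' hm]
    simp only [lt_irrefl, if_false]
    nlinarith

/-! ### The divisor estimate -/

lemma meromorphicOrderAt_const_of_ne_zero {c : ℂ} (hc : c ≠ 0) (z : ℂ) :
    meromorphicOrderAt (fun _ ↦ c) z = 0 := by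
  classical
  simp [meromorphicOrderAt_const, hc]

lemma meromorphicOrderAt_sub_one_of_neg {g : ℂ → ℂ} {z : ℂ} (h : meromorphicOrderAt g z < 0) :
    meromorphicOrderAt (fun w ↦ g w - 1) z = meromorphicOrderAt g z := by
  have h1 : (fun w ↦ g w - 1) = g + fun _ ↦ (-1 : ℂ) := by ext w; simp [sub_eq_add_neg]
  rw [h1, meromorphicOrderAt_add_eq_left_of_lt (MeromorphicAt.const _ _)]
  rwa [meromorphicOrderAt_const_of_ne_zero (by simp)]

lemma meromorphicOrderAt_sub_one_of_pos {g : ℂ → ℂ} {z : ℂ} (h : 0 < meromorphicOrderAt g z) :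
    meromorphicOrderAt (fun w ↦ g w - 1) z = 0 := by
  have h1 : (fun w ↦ g w - 1) = g + fun _ ↦ (-1 : ℂ) := by ext w; simp [sub_eq_add_neg]
  have h2 := meromorphicOrderAt_const_of_ne_zero (c := -1) (by simp) z
  rw [h1, meromorphicOrderAt_add_eq_right_of_lt
    (meromorphicAt_of_meromorphicOrderAt_ne_zero h.ne') (by rwa [h2]), h2]

lemma meromorphicOrderAt_sub_one_nonneg {g : ℂ → ℂ} {z : ℂ} (hg : MeromorphicAt g z)
    (h : 0 ≤ meromorphicOrderAt g z) : 0 ≤ meromorphicOrderAt (fun w ↦ g w - 1) z := by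
  obtain ⟨g', hg', hgg'⟩ := hg.meromorphicOrderAt_nonneg_iff.1 h
  refine (hg.fun_sub (MeromorphicAt.const 1 z)).meromorphicOrderAt_nonneg_iff.2
    ⟨fun w ↦ g' w - 1, hg'.fun_sub analyticAt_const, ?_⟩
  filter_upwards [hgg'] with w hw
  rw [hw]

lemma logDeriv_sub_one (g : ℂ → ℂ) :
    logDeriv (fun w ↦ g w - 1) = fun w ↦ deriv g w / (g w - 1) := by
  ext w
  simp [logDeriv_apply]

variable {k : ℕ} {q : ℕ → ℕ} {a : ℂ}

/-- The divisor estimate behind the main inequality: every zero of `f` of multiplicity `p` is a zero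
of `M' / (M - 1)` of multiplicity at least `μ p - μ_* - 1`, and the poles of `M' / (M - 1)` are
simple and lie at the poles of `f` and the zeros of `M - 1`. -/
theorem divisor_estimate (hf : IsTranscendentalMeromorphic f) (ha : a ≠ 0) (hq0 : 1 ≤ q 0)
    (hM : ∀ z, meromorphicOrderAt (fun w ↦ monomial a k q f w - 1) z ≠ ⊤)
    (hG : ∀ z, meromorphicOrderAt (logDeriv fun w ↦ monomial a k q f w - 1) z ≠ ⊤) :
    (degree k q : ℤ) • (divisor f univ)⁺ -
        divisor (logDeriv fun w ↦ monomial a k q f w - 1) univ ≤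
      (divisor f univ)⁻ + (starDegree k q + 1 : ℤ) • (divisor f univ)⁺ +
        reducedPoleDivisor (fun w ↦ 1 / (monomial a k q f w - 1)) := by
  intro z
  have hmer := meromorphic_monomial hf.1 a k q
  have hsub : Meromorphic fun w ↦ monomial a k q f w - 1 :=
    fun w ↦ (hmer w).fun_sub (MeromorphicAt.const 1 w)
  have hinv : Meromorphic fun w ↦ 1 / (monomial a k q f w - 1) :=
    fun w ↦ (MeromorphicAt.const 1 w).fun_div (hsub w)
  obtain ⟨m, hm, h1, h2⟩ := hf.exists_order_iteratedDeriv z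
  have hp : meromorphicOrderAt f z = m 0 := by simpa using hm 0
  have hMz := meromorphicOrderAt_monomial hf.1 ha k q hm
  set mM : ℤ := ∑ i ∈ Finset.range (k + 1), (q i : ℤ) * m i
  obtain ⟨s, hs⟩ := WithTop.ne_top_iff_exists.1 (hM z)
  obtain ⟨g, hg⟩ := WithTop.ne_top_iff_exists.1 (hG z)
  have hred : reducedPoleDivisor (fun w ↦ 1 / (monomial a k q f w - 1)) z =
      if 0 < s then 1 else 0 := by
    have h3 : meromorphicOrderAt (fun w ↦ 1 / (monomial a k q f w - 1)) z = (-s : ℤ) := by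
      simp_rw [one_div]
      refine (meromorphicOrderAt_inv (f := fun w ↦ monomial a k q f w - 1)).trans ?_
      rw [← hs]
      rfl
    change (if divisor _ univ z < 0 then (1 : ℤ) else 0) = _
    rw [divisor_apply hinv.meromorphicOn (mem_univ z), h3]
    simp
  have hD : divisor f univ z = m 0 := by
    rw [divisor_apply hf.1.meromorphicOn (mem_univ z), hp]
    rfl
  have hE : divisor (logDeriv fun w ↦ monomial a k q f w - 1) univ z = g := by
    rw [divisor_apply hsub.logDeriv.meromorphicOn (mem_univ z), ← hg]
    rfl
  have hdeg : 1 ≤ (degree k q : ℤ) := by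
    have : q 0 ≤ degree k q := Finset.single_le_sum (f := q) (fun _ _ ↦ Nat.zero_le _) (by simp)
    omega
  have key := order_estimate (p := m 0) (m := mM) (s := s) (g := g) (μ := degree k q)
    (ν := starDegree k q) (by positivity) ?_ ?_ ?_ ?_ ?_ ?_ ?_ ?_ ?_ ?_
  · simp only [one_div] at hred
    simpa [hD, hE, hred] using key
  · intro h
    have := sum_order_of_neg (k := k) (q := q) h1 h
    have h3 : (degree k q : ℤ) * m 0 < 0 := mul_neg_of_pos_of_neg (by omega) h
    omega
  · intro h
    have := mul_le_sum_order (k := k) (q := q) h2 h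
    have h3 : 0 ≤ (q 0 : ℤ) * m 0 := by positivity
    omega
  · intro h
    have := mul_le_sum_order (k := k) (q := q) h2 h.le
    have h3 : 0 < (q 0 : ℤ) * m 0 := mul_pos (by omega) h
    omega
  · exact le_sum_order h1 h2
  · intro h
    have := meromorphicOrderAt_sub_one_of_neg (g := monomial a k q f) (z := z)
      (by rw [hMz]; exact_mod_cast h)
    rw [hMz, ← hs] at this
    exact_mod_cast this
  · intro h
    have := meromorphicOrderAt_sub_one_of_pos (g := monomial a k q f) (z := z)
      (by rw [hMz]; exact_mod_cast h)
    rw [← hs] at this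
    exact_mod_cast this
  · intro h
    have := meromorphicOrderAt_sub_one_nonneg (hmer z) (by rw [hMz, h]; simp)
    rw [← hs] at this
    exact_mod_cast this
  · intro h
    have := meromorphicOrderAt_logDeriv_eq_neg_one (hsub z)
      (by rw [← hs]; exact_mod_cast h) (hM z)
    rw [← hg] at this
    exact WithTop.coe_injective this
  · intro h
    have := meromorphicOrderAt_logDeriv_nonneg (hsub z) (by rw [← hs, h]; rfl)
    rw [← hg] at this
    exact_mod_cast this
  · intro h
    have h3 := meromorphicOrderAt_sub_one_of_pos (g := monomial a k q f) (z := z)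
      (by rw [hMz]; exact_mod_cast h)
    have h4 := meromorphicOrderAt_deriv_eq_sub_one (Int.cast_ne_zero.2 h.ne') hMz
    have h5 : meromorphicOrderAt (fun w ↦ deriv (monomial a k q f) w /
        (monomial a k q f w - 1)) z = _ := meromorphicOrderAt_div (hmer z).deriv (hsub z)
    rw [← logDeriv_sub_one, h3, h4, sub_zero, ← hg] at h5
    exact_mod_cast h5

end

section

variable {f g h : ℂ → ℂ}

/-! ### Quantities of logarithmic size -/

/-- The size `log r + log⁺ T(r, f)` of the error terms in the theory of `f`. -/
noncomputable def logGauge (f : ℂ → ℂ) (r : ℝ) : ℝ := log r + log⁺ (characteristic f ⊤ r)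

lemma isBigO_of_le {u v : ℝ → ℝ} (h : ∀ r, 1 ≤ r → 0 ≤ u r ∧ u r ≤ v r) :
    u =O[atTopOffFinite] v := by
  refine IsBigO.of_bound 1 (((eventually_ge_atTop 1).filter_mono
    atTopOffFinite_le_atTop).mono fun r hr ↦ ?_)
  obtain ⟨h1, h2⟩ := h r hr
  rw [Real.norm_of_nonneg h1, Real.norm_of_nonneg (h1.trans h2), one_mul]
  exact h2

lemma proximity_top_nonneg (g : ℂ → ℂ) (r : ℝ) : 0 ≤ proximity g ⊤ r :=
  proximity_nonneg (f := g) (a := ⊤) r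

lemma log_isBigO_logGauge (f : ℂ → ℂ) : log =O[atTopOffFinite] logGauge f :=
  isBigO_of_le fun _ hr ↦ ⟨log_nonneg hr, le_add_of_nonneg_right posLog_nonneg⟩

lemma const_isBigO_logGauge (f : ℂ → ℂ) (c : ℝ) : (fun _ ↦ c) =O[atTopOffFinite] logGauge f :=
  (isLittleO_const_log_atTop.isBigO.mono atTopOffFinite_le_atTop).trans (log_isBigO_logGauge f)

namespace IsTranscendentalMeromorphic

lemma logGauge_isLittleO_atTop (hf : IsTranscendentalMeromorphic f) :
    logGauge f =o[atTop] characteristic f ⊤ := by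
  refine hf.log_isLittleO_characteristic.add ?_
  refine (isLittleO_log_id_atTop.comp_tendsto hf.tendsto_characteristic_atTop).congr' ?_
    EventuallyEq.rfl
  filter_upwards [hf.tendsto_characteristic_atTop.eventually_ge_atTop 1] with r hr
  exact (posLog_eq_log (hr.trans (le_abs_self _))).symm

lemma not_characteristic_isBigO_logGauge (hf : IsTranscendentalMeromorphic f) :
    ¬ characteristic f ⊤ =O[atTopOffFinite] logGauge f := by
  intro hO
  have h1 := hO.trans_isLittleO (hf.logGauge_isLittleO_atTop.mono atTopOffFinite_le_atTop)
  have h2 := h1.bound (c := 1 / 2) (by norm_num)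
  have h3 := (hf.tendsto_characteristic_atTop.eventually_gt_atTop 0).filter_mono
    atTopOffFinite_le_atTop
  obtain ⟨r, h4, h5⟩ := (h2.and h3).exists
  rw [Real.norm_of_nonneg h5.le] at h4
  linarith

end IsTranscendentalMeromorphic

/-- `g` is meromorphic and `m(r, g) = O(log r + log⁺ T(r, f))` off a set of finite measure. -/
def HasSmallProximity (f g : ℂ → ℂ) : Prop :=
  Meromorphic g ∧ proximity g ⊤ =O[atTopOffFinite] logGauge f

namespace HasSmallProximity

lemma const (f : ℂ → ℂ) (c : ℂ) : HasSmallProximity f fun _ ↦ c := by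
  refine ⟨fun z ↦ MeromorphicAt.const c z, ?_⟩
  convert const_isBigO_logGauge f (log⁺ ‖c‖) using 2
  exact proximity_const

lemma mul (hg : HasSmallProximity f g) (hh : HasSmallProximity f h) :
    HasSmallProximity f (g * h) := by
  refine ⟨hg.1.mul hh.1, (isBigO_of_le fun r _ ↦ ⟨proximity_top_nonneg _ r, ?_⟩).trans
    (hg.2.add hh.2)⟩
  exact proximity_mul_top_le hg.1 hh.1 r

lemma pow (hg : HasSmallProximity f g) (n : ℕ) : HasSmallProximity f (g ^ n) := by
  refine ⟨hg.1.pow, ?_⟩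
  rw [proximity_pow_top, ← Nat.cast_smul_eq_nsmul ℝ]
  exact hg.2.const_smul_left _

lemma congr (hg : HasSmallProximity f g) (hgh : g =ᶠ[codiscrete ℂ] h) :
    HasSmallProximity f h := by
  refine ⟨hg.1.congr_codiscrete hgh, hg.2.congr' ?_ EventuallyEq.rfl⟩
  filter_upwards [(eventually_gt_atTop 0).filter_mono atTopOffFinite_le_atTop] with r hr
  exact proximity_congr_codiscrete hgh hr.ne'

lemma prod {ι : Type*} (s : Finset ι) {F : ι → ℂ → ℂ} (hF : ∀ i, HasSmallProximity f (F i)) :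
    HasSmallProximity f (∏ i ∈ s, F i) := by
  classical
  induction s using Finset.induction with
  | empty => exact const f 1
  | insert i s hi ih =>
    rw [Finset.prod_insert hi]
    exact (hF i).mul ih

end HasSmallProximity

/-- `g` is a meromorphic function, not identically zero, with `T(r, g) = O(T(r, f))` off a set of
finite measure. -/
def IsDominated (f g : ℂ → ℂ) : Prop :=
  Meromorphic g ∧ (∀ z, meromorphicOrderAt g z ≠ ⊤) ∧
    characteristic g ⊤ =O[atTopOffFinite] characteristic f ⊤

namespace IsDominated

lemma hasSmallProximity_logDeriv (hg : IsDominated f g) :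
    HasSmallProximity f (logDeriv g) := by
  refine ⟨hg.1.logDeriv, (isBigO_proximity_logDeriv hg.1 hg.2.1).trans
    ((log_isBigO_logGauge f).add ?_)⟩
  obtain ⟨C, hC⟩ := hg.2.2.bound
  have h1 : (fun r ↦ log⁺ (characteristic g ⊤ r)) =O[atTopOffFinite]
      fun r ↦ log⁺ C + log⁺ (characteristic f ⊤ r) := by
    refine IsBigO.of_bound 1 ?_
    filter_upwards [hC, (eventually_ge_atTop 1).filter_mono atTopOffFinite_le_atTop] with r h1 h2
    have h3 := characteristic_nonneg (f := g) (a := ⊤) h2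
    have h4 := characteristic_nonneg (f := f) (a := ⊤) h2
    rw [Real.norm_of_nonneg h3, Real.norm_of_nonneg h4] at h1
    rw [Real.norm_of_nonneg posLog_nonneg, Real.norm_of_nonneg
      (add_nonneg posLog_nonneg posLog_nonneg), one_mul]
    exact (posLog_le_posLog h3 h1).trans posLog_mul
  exact h1.trans ((const_isBigO_logGauge f _).add
    (isBigO_of_le fun _ hr ↦ ⟨posLog_nonneg, le_add_of_nonneg_left (log_nonneg hr)⟩))

lemma const (hf : IsTranscendentalMeromorphic f) {c : ℂ} (hc : c ≠ 0) :
    IsDominated f fun _ ↦ c := by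
  refine ⟨fun z ↦ MeromorphicAt.const c z, fun z ↦ ?_, ?_⟩
  · rw [meromorphicOrderAt_const_of_ne_zero hc]
    simp
  · have h1 : characteristic (fun _ : ℂ ↦ c) ⊤ = fun _ ↦ log⁺ ‖c‖ := by
      ext r
      simp [characteristic]
    rw [h1]
    exact (const_isBigO_logGauge f _).trans
      (hf.logGauge_isLittleO_atTop.mono atTopOffFinite_le_atTop).isBigO

lemma mul (hg : IsDominated f g) (hh : IsDominated f h) : IsDominated f (g * h) := by
  refine ⟨hg.1.mul hh.1, fun z ↦ ?_, ?_⟩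
  · rw [meromorphicOrderAt_mul (hg.1 z) (hh.1 z)]
    exact WithTop.add_ne_top.2 ⟨hg.2.1 z, hh.2.1 z⟩
  · exact (isBigO_of_le fun r hr ↦ ⟨characteristic_nonneg hr,
      characteristic_mul_top_le hr hg.1 hg.2.1 hh.1 hh.2.1⟩).trans (hg.2.2.add hh.2.2)

lemma pow (hf : IsTranscendentalMeromorphic f) (hg : IsDominated f g) (n : ℕ) :
    IsDominated f (g ^ n) := by
  induction n with
  | zero => rw [pow_zero]; exact const hf one_ne_zero
  | succ n ih => rw [pow_succ]; exact ih.mul hg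

lemma prod (hf : IsTranscendentalMeromorphic f) {ι : Type*} (s : Finset ι) {F : ι → ℂ → ℂ}
    (hF : ∀ i, IsDominated f (F i)) : IsDominated f (∏ i ∈ s, F i) := by
  classical
  induction s using Finset.induction with
  | empty => exact const hf one_ne_zero
  | insert i s hi ih =>
    rw [Finset.prod_insert hi]
    exact (hF i).mul ih

lemma sub_one (hf : IsTranscendentalMeromorphic f) (hg : IsDominated f g)
    (hg' : ∀ z, meromorphicOrderAt (fun w ↦ g w - 1) z ≠ ⊤) :
    IsDominated f fun w ↦ g w - 1 := by
  refine ⟨fun z ↦ (hg.1 z).fun_sub (MeromorphicAt.const 1 z), hg', ?_⟩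
  have h1 : (fun w ↦ g w - 1) = g + fun _ ↦ (-1 : ℂ) := by ext w; simp [sub_eq_add_neg]
  have hc := const (f := f) hf (c := -1) (by simp)
  have h2 : (fun _ ↦ log 2) =O[atTopOffFinite] characteristic f ⊤ :=
    (const_isBigO_logGauge f _).trans
      (hf.logGauge_isLittleO_atTop.mono atTopOffFinite_le_atTop).isBigO
  rw [h1]
  exact (isBigO_of_le fun r hr ↦ ⟨characteristic_nonneg hr,
      characteristic_add_top_le hg.1 hc.1 hr⟩).trans ((hg.2.2.add hc.2.2).add h2)

end IsDominated

/-- Each pole of `g` of order `n` is a pole of `g'` of order `n + 1 ≤ 2 n`. -/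
lemma logCounting_deriv_le (hg : Meromorphic g) (hg' : ∀ z, meromorphicOrderAt g z ≠ ⊤) {r : ℝ}
    (hr : 1 ≤ r) : logCounting (deriv g) ⊤ r ≤ 2 * logCounting g ⊤ r := by
  have h1 : (divisor (deriv g) univ)⁻ ≤ (2 : ℤ) • (divisor g univ)⁻ := by
    intro z
    obtain ⟨n, hn⟩ := WithTop.ne_top_iff_exists.1 (hg' z)
    have h2 : divisor g univ z = n := by
      rw [divisor_apply hg.meromorphicOn (mem_univ z), ← hn]
      rfl
    suffices (divisor (deriv g) univ z)⁻ ≤ 2 * n⁻ by simpa [h2] using this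
    rw [divisor_apply hg.deriv.meromorphicOn (mem_univ z)]
    rcases lt_or_ge n 0 with h | h
    · rw [meromorphicOrderAt_deriv_eq_sub_one (Int.cast_ne_zero.2 h.ne) hn.symm,
        negPart_eq_neg.2 h.le]
      change (n - 1)⁻ ≤ _
      rw [negPart_eq_neg.2 (by omega)]
      omega
    · have h3 := meromorphicOrderAt_deriv_nonneg (hg z) (by rw [← hn]; exact_mod_cast h)
      rw [negPart_eq_zero.2 (WithTop.untop₀_nonneg.2 h3), negPart_eq_zero.2 h]
      simp
  have h2 := Function.locallyFinsuppWithin.logCounting_le h1 hr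
  rw [map_zsmul] at h2
  simpa [logCounting_top] using h2

lemma eventually_codiscrete_ne_zero (hg : Meromorphic g)
    (hg' : ∀ z, meromorphicOrderAt g z ≠ ⊤) : ∀ᶠ z in codiscrete ℂ, g z ≠ 0 := by
  refine mem_codiscreteWithin_iff_forall_mem_nhdsNE.2 fun z _ ↦ ?_
  filter_upwards [(meromorphicOrderAt_ne_top_iff_eventually_ne_zero (hg z)).1 (hg' z)] with w hw
    using Or.inl hw

lemma deriv_eventuallyEq_mul_logDeriv (hg : Meromorphic g)
    (hg' : ∀ z, meromorphicOrderAt g z ≠ ⊤) : deriv g =ᶠ[codiscrete ℂ] g * logDeriv g := by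
  filter_upwards [eventually_codiscrete_ne_zero hg hg'] with z hz
  rw [Pi.mul_apply, logDeriv_apply, mul_div_cancel₀ _ hz]

namespace IsTranscendentalMeromorphic

/-- `T(r, f^(i)) = O(T(r, f))` off a set of finite measure. -/
theorem isDominated_iteratedDeriv (hf : IsTranscendentalMeromorphic f) (i : ℕ) :
    IsDominated f (iteratedDeriv i f) := by
  induction i with
  | zero =>
    refine ⟨meromorphic_iteratedDeriv hf.1 0, hf.meromorphicOrderAt_iteratedDeriv_ne_top 0, ?_⟩
    simpa using isBigO_refl _ _
  | succ i ih =>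
    refine ⟨meromorphic_iteratedDeriv hf.1 _, hf.meromorphicOrderAt_iteratedDeriv_ne_top _, ?_⟩
    have hs := ih.hasSmallProximity_logDeriv
    have h1 : characteristic (iteratedDeriv (i + 1) f) ⊤ =O[atTopOffFinite]
        fun r ↦ 2 * characteristic (iteratedDeriv i f) ⊤ r +
          proximity (logDeriv (iteratedDeriv i f)) ⊤ r := by
      refine isBigO_of_le fun r hr ↦ ⟨characteristic_nonneg hr, ?_⟩
      have h2 := proximity_mul_top_le ih.1 hs.1 r
      rw [← proximity_congr_codiscrete (deriv_eventuallyEq_mul_logDeriv ih.1 ih.2.1)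
        (by linarith : r ≠ 0)] at h2
      have h3 := logCounting_deriv_le ih.1 ih.2.1 hr
      have h4 := proximity_top_nonneg (iteratedDeriv i f) r
      rw [iteratedDeriv_succ]
      simp only [characteristic, Pi.add_apply] at h2 ⊢
      linarith
    exact h1.trans ((ih.2.2.const_mul_left 2).add (hs.2.trans
      (hf.logGauge_isLittleO_atTop.mono atTopOffFinite_le_atTop).isBigO))

/-- `m(r, f^(i) / f)` is small. -/
theorem hasSmallProximity_iteratedDeriv_div (hf : IsTranscendentalMeromorphic f) (i : ℕ) :
    HasSmallProximity f (iteratedDeriv i f / f) := by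
  have hne := eventually_codiscrete_ne_zero hf.1 hf.meromorphicOrderAt_ne_top
  induction i with
  | zero =>
    refine (HasSmallProximity.const f 1).congr ?_
    filter_upwards [hne] with z hz
    simp [hz]
  | succ i ih =>
    have hd := hf.isDominated_iteratedDeriv i
    refine (ih.mul (hd.hasSmallProximity_logDeriv)).congr ?_
    filter_upwards [deriv_eventuallyEq_mul_logDeriv hd.1 hd.2.1] with z hz
    rw [iteratedDeriv_succ, Pi.div_apply, hz]
    simp only [Pi.mul_apply, Pi.div_apply]
    ring

theorem isDominated_monomial (hf : IsTranscendentalMeromorphic f) {a : ℂ} (ha : a ≠ 0) (k : ℕ)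
    (q : ℕ → ℕ) : IsDominated f (monomial a k q f) := by
  have h1 := (IsDominated.const hf ha).mul (IsDominated.prod hf (Finset.range (k + 1))
    fun i ↦ (hf.isDominated_iteratedDeriv i).pow hf (q i))
  convert h1 using 1
  ext z
  simp [monomial, Finset.prod_apply]

end IsTranscendentalMeromorphic

end

section

variable {f : ℂ → ℂ} {a : ℂ} {k : ℕ} {q : ℕ → ℕ}

/-! ### The main inequality -/

/-- A function whose derivative vanishes identically is constant. -/
lemma exists_eventuallyEq_const {g : ℂ → ℂ} (hg : Meromorphic g) {z : ℂ}
    (h : meromorphicOrderAt (deriv g) z = ⊤) : ∃ c : ℂ, g =ᶠ[codiscrete ℂ] fun _ ↦ c := by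
  obtain ⟨z₀, hz₀⟩ : ∃ z₀, AnalyticAt ℂ g z₀ := (hg z).eventually_analyticAt.exists
  have h0 : deriv g =ᶠ[𝓝 z₀] 0 :=
    (hz₀.deriv.continuousAt.eventuallyEq_nhds_iff_eventuallyEq_nhdsNE continuousAt_const).1
      (meromorphicOrderAt_eq_top_iff.1 (meromorphicOrderAt_eq_top_of_exists hg.deriv h z₀))
  obtain ⟨ε, hε, hball⟩ := Metric.eventually_nhds_iff_ball.1 (h0.and hz₀.eventually_analyticAt)
  refine ⟨g z₀, ?_⟩
  have hsub : Meromorphic fun w ↦ g w - g z₀ := fun w ↦ (hg w).fun_sub (MeromorphicAt.const _ w)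
  have h1 : meromorphicOrderAt (fun w ↦ g w - g z₀) z₀ = ⊤ := by
    rw [meromorphicOrderAt_eq_top_iff]
    filter_upwards [nhdsWithin_le_nhds (ball_mem_nhds z₀ hε)] with w hw
    rw [sub_eq_zero]
    exact isOpen_ball.is_const_of_deriv_eq_zero (convex_ball z₀ ε).isPreconnected
      (fun w hw ↦ (hball w hw).2.differentiableAt.differentiableWithinAt)
      (fun w hw ↦ (hball w hw).1) hw (mem_ball_self hε)
  filter_upwards [eventuallyEq_codiscrete_zero (meromorphicOrderAt_eq_top_of_exists hsub h1)]
    with w hw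
  simpa [sub_eq_zero] using hw

namespace IsTranscendentalMeromorphic

/-- `μ m(r, 1/f) ≤ m(r, 1/M)` up to a small error, since `f ^ (-μ)` is the product of `1 / M` and
powers of the functions `f^(i) / f`. -/
lemma exists_degree_mul_proximity_inv_le (hf : IsTranscendentalMeromorphic f) (ha : a ≠ 0)
    (k : ℕ) (q : ℕ → ℕ) :
    ∃ e : ℝ → ℝ, e =O[atTopOffFinite] logGauge f ∧ ∀ r, 1 ≤ r →
      degree k q * proximity f⁻¹ ⊤ r ≤ proximity (monomial a k q f)⁻¹ ⊤ r + e r := by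
  set Q : ℂ → ℂ := (fun _ ↦ a) * ∏ i ∈ Finset.range (k + 1), (iteratedDeriv i f / f) ^ q i with hQ
  have hQs : HasSmallProximity f Q := (HasSmallProximity.const f a).mul
    (HasSmallProximity.prod _ fun i ↦ (hf.hasSmallProximity_iteratedDeriv_div i).pow (q i))
  refine ⟨proximity Q ⊤, hQs.2, fun r hr ↦ ?_⟩
  have hM := hf.isDominated_monomial ha k q
  have h1 : f⁻¹ ^ degree k q =ᶠ[codiscrete ℂ] (monomial a k q f)⁻¹ * Q := by
    filter_upwards [eventually_codiscrete_ne_zero hM.1 hM.2.1,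
      eventually_codiscrete_ne_zero hf.1 hf.meromorphicOrderAt_ne_top] with z hz hz'
    rw [Pi.mul_apply, Pi.inv_apply, Pi.pow_apply, Pi.inv_apply, eq_inv_mul_iff_mul_eq₀ hz]
    simp only [hQ, monomial, Pi.mul_apply, Finset.prod_apply, Pi.pow_apply, Pi.div_apply, div_pow,
      Finset.prod_div_distrib, degree, ← Finset.prod_pow_eq_pow_sum, inv_pow,
      Finset.prod_inv_distrib]
    ring
  have h2 := proximity_mul_top_le hM.1.inv hQs.1 r
  rw [← proximity_congr_codiscrete h1 (by linarith : r ≠ 0), proximity_pow_top] at h2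
  simpa using h2

lemma characteristic_inv_eq (f : ℂ → ℂ) (r : ℝ) : characteristic f⁻¹ ⊤ r =
    proximity f⁻¹ ⊤ r + Function.locallyFinsuppWithin.logCounting (divisor f univ)⁺ r := by
  rw [characteristic, Pi.add_apply, logCounting_inv, logCounting_zero]

lemma characteristic_le_inv (hf : IsTranscendentalMeromorphic f) {r : ℝ} (hr : 1 ≤ r) :
    characteristic f ⊤ r ≤ characteristic f⁻¹ ⊤ r + |log ‖meromorphicTrailingCoeffAt f⁻¹ 0‖| := by
  simpa using characteristic_inv_le hf.1.inv (by linarith : r ≠ 0)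

/-- If `M` were a constant, then `f` would have no zeros and `m(r, 1/f)` would be small. -/
theorem monomial_not_eventuallyEq_const (hf : IsTranscendentalMeromorphic f) (ha : a ≠ 0)
    (hq0 : 1 ≤ q 0) (c : ℂ) : ¬ monomial a k q f =ᶠ[codiscrete ℂ] fun _ ↦ c := by
  intro hconst
  have hM := hf.isDominated_monomial ha k q
  have hnhds : ∀ z, monomial a k q f =ᶠ[𝓝[≠] z] fun _ ↦ c := fun z ↦ by
    filter_upwards [mem_codiscreteWithin_iff_forall_mem_nhdsNE.1 hconst z (mem_univ z)] with w hw
    simpa using hw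
  have hc : c ≠ 0 := by
    rintro rfl
    exact hM.2.1 0 (meromorphicOrderAt_eq_top_iff.2 (hnhds 0))
  have hD : (divisor f univ)⁺ = 0 := by
    refine posPart_eq_zero.2 fun z ↦ ?_
    obtain ⟨m, hm, h1, h2⟩ := hf.exists_order_iteratedDeriv z
    have h3 : divisor f univ z = m 0 := by
      rw [divisor_apply hf.1.meromorphicOn (mem_univ z)]
      have := hm 0
      rw [iteratedDeriv_zero] at this
      rw [this]
      rfl
    have h4 := meromorphicOrderAt_monomial hf.1 ha k q hm
    rw [meromorphicOrderAt_congr (hnhds z), meromorphicOrderAt_const_of_ne_zero hc] at h4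
    have h5 : (0 : ℤ) = ∑ i ∈ Finset.range (k + 1), (q i : ℤ) * m i := WithTop.coe_injective h4
    rw [h3]
    change m 0 ≤ 0
    by_contra! hpos
    have h6 := mul_le_sum_order (k := k) (q := q) h2 hpos.le
    have h7 : 0 < (q 0 : ℤ) * m 0 := mul_pos (by omega) hpos
    omega
  obtain ⟨e, he, hle⟩ := hf.exists_degree_mul_proximity_inv_le ha k q
  refine hf.not_characteristic_isBigO_logGauge ((isBigO_of_le
    (v := fun r ↦ log⁺ ‖c⁻¹‖ + e r + |log ‖meromorphicTrailingCoeffAt f⁻¹ 0‖|)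
    fun r hr ↦ ⟨characteristic_nonneg hr, ?_⟩).trans
    (((const_isBigO_logGauge f _).add he).add (const_isBigO_logGauge f _)))
  have h1 := hle r hr
  have h2 := hf.characteristic_le_inv hr
  rw [characteristic_inv_eq, hD, map_zero, Pi.zero_apply, add_zero] at h2
  have h3 : proximity (monomial a k q f)⁻¹ ⊤ r = log⁺ ‖c⁻¹‖ := by
    rw [proximity_congr_codiscrete (g := fun _ ↦ c⁻¹) ?_ (by linarith : r ≠ 0), proximity_const]
    filter_upwards [hconst] with w hw
    rw [Pi.inv_apply, hw]
  have h4 : (1 : ℝ) ≤ degree k q := by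
    have : q 0 ≤ degree k q := Finset.single_le_sum (f := q) (fun _ _ ↦ Nat.zero_le _) (by simp)
    exact_mod_cast hq0.trans this
  have h5 := le_mul_of_one_le_left (proximity_top_nonneg f⁻¹ r) h4
  linarith

/-- The main inequality, with an explicit size of the error term. -/
theorem exists_mul_characteristic_le (hf : IsTranscendentalMeromorphic f) (ha : a ≠ 0)
    (hq0 : 1 ≤ q 0) :
    ∃ e : ℝ → ℝ, e =O[atTopOffFinite] logGauge f ∧ ∀ r, 1 ≤ r →
      ((degree k q : ℝ) - starDegree k q - 2) * characteristic f ⊤ r ≤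
        reducedLogCounting (fun z ↦ 1 / (monomial a k q f z - 1)) r + e r := by
  set M := monomial a k q f with hMdef
  have hM : IsDominated f M := hf.isDominated_monomial ha k q
  have hM' : ∀ z, meromorphicOrderAt (deriv M) z ≠ ⊤ := by
    intro z hz
    obtain ⟨c, hc⟩ := exists_eventuallyEq_const hM.1 hz
    exact hf.monomial_not_eventuallyEq_const ha hq0 c hc
  have hsub : Meromorphic fun w ↦ M w - 1 := fun w ↦ (hM.1 w).fun_sub (MeromorphicAt.const 1 w)
  have hM1 : ∀ z, meromorphicOrderAt (fun w ↦ M w - 1) z ≠ ⊤ := by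
    intro z hz
    refine hf.monomial_not_eventuallyEq_const (k := k) ha hq0 1 ?_
    filter_upwards [eventuallyEq_codiscrete_zero (meromorphicOrderAt_eq_top_of_exists hsub hz)]
      with w hw
    simpa [sub_eq_zero] using hw
  set G := logDeriv fun w ↦ M w - 1 with hG
  have hGeq : G = fun w ↦ deriv M w / (M w - 1) := logDeriv_sub_one M
  have hGm : Meromorphic G := hsub.logDeriv
  have hG' : ∀ z, meromorphicOrderAt G z ≠ ⊤ := by
    intro z
    obtain ⟨m, hm⟩ := WithTop.ne_top_iff_exists.1 (hM' z)
    obtain ⟨n, hn⟩ := WithTop.ne_top_iff_exists.1 (hM1 z)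
    rw [hGeq]
    have : meromorphicOrderAt (fun w ↦ deriv M w / (M w - 1)) z = _ :=
      meromorphicOrderAt_div (hM.1 z).deriv (hsub z)
    rw [this, ← hm, ← hn]
    exact WithTop.coe_ne_top
  have hMlog := hM.hasSmallProximity_logDeriv
  have hGs : HasSmallProximity f G := (hM.sub_one hf hM1).hasSmallProximity_logDeriv
  obtain ⟨e, he, hle⟩ := hf.exists_degree_mul_proximity_inv_le ha k q
  set c₁ := |log ‖meromorphicTrailingCoeffAt f⁻¹ 0‖|
  set c₂ := |log ‖meromorphicTrailingCoeffAt f 0‖|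
  set c₃ := log ‖meromorphicTrailingCoeffAt G 0‖
  set d : ℝ := degree k q * c₁ + (starDegree k q + 1) * c₂ + |c₃| + log 2 with hd
  refine ⟨fun r ↦ e r + proximity (logDeriv M) ⊤ r + proximity G ⊤ r + d,
    ((he.add hMlog.2).add hGs.2).add (const_isBigO_logGauge f d), fun r hr ↦ ?_⟩
  have hr0 : r ≠ 0 := by linarith
  -- `1 / M = 1 - (M' / M) / G`
  have h1 : proximity M⁻¹ ⊤ r ≤ proximity (logDeriv M) ⊤ r + proximity G⁻¹ ⊤ r + log 2 := by
    have hc : ∀ c : ℂ, Meromorphic fun _ : ℂ ↦ c := fun c z ↦ MeromorphicAt.const c z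
    have heq : M⁻¹ =ᶠ[codiscrete ℂ]
        (fun _ ↦ 1) + (fun _ ↦ -1) * (logDeriv M * G⁻¹) := by
      filter_upwards [eventually_codiscrete_ne_zero hM.1 hM.2.1,
        eventually_codiscrete_ne_zero hM.1.deriv hM',
        eventually_codiscrete_ne_zero hsub hM1] with z h1 h2 h3
      have h4 : M z - 1 ≠ 0 := h3
      simp only [Pi.inv_apply, Pi.add_apply, Pi.mul_apply, logDeriv_apply, hGeq]
      field_simp
      ring
    have h2 := proximity_add_top_le (hc 1) ((hc (-1)).mul (hMlog.1.mul hGm.inv)) r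
    have h3 := proximity_mul_top_le (hc (-1)) (hMlog.1.mul hGm.inv) r
    have h4 := proximity_mul_top_le hMlog.1 hGm.inv r
    rw [← proximity_congr_codiscrete heq hr0] at h2
    simp only [Pi.add_apply, proximity_const, norm_neg, norm_one, posLog_one] at h2 h3 h4
    linarith
  -- Jensen's formula for `G`
  have h2 : proximity G⁻¹ ⊤ r = proximity G ⊤ r -
      Function.locallyFinsuppWithin.logCounting (divisor G univ) r - c₃ := by
    have h3 := congrFun (proximity_sub_proximity_inv_eq_circleAverage hGm) r
    have h4 := Function.locallyFinsuppWithin.logCounting_divisor_eq_circleAverage_sub_const hGm hr0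
    rw [Pi.sub_apply] at h3
    linarith
  have h3 := Function.locallyFinsuppWithin.logCounting_le
    (divisor_estimate hf ha hq0 hM1 hG') hr
  rw [← hMdef, ← hG] at h3
  simp only [map_sub, map_add, map_zsmul, Pi.sub_apply, Pi.add_apply, Pi.smul_apply] at h3
  simp only [zsmul_eq_mul] at h3
  push_cast at h3
  have h4 := hle r hr
  have h5 := hf.characteristic_le_inv hr
  have h6 := characteristic_inv_le hf.1 hr0
  have h7 := characteristic_inv_eq f r
  have h8 := proximity_top_nonneg f⁻¹ r
  have h9 := proximity_top_nonneg f r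
  have h10 : characteristic f ⊤ r = proximity f ⊤ r +
      Function.locallyFinsuppWithin.logCounting (divisor f univ)⁻ r := by
    rw [characteristic, Pi.add_apply, logCounting_top]
  have h11 := neg_abs_le c₃
  have h12 : (degree k q : ℝ) * characteristic f ⊤ r ≤
      degree k q * (characteristic f⁻¹ ⊤ r + c₁) := by gcongr
  have h13 : (starDegree k q + 1 : ℝ) *
      Function.locallyFinsuppWithin.logCounting (divisor f univ)⁺ r ≤
      (starDegree k q + 1) * (characteristic f ⊤ r + c₂) := by
    gcongr
    linarith
  rw [h7] at h12
  simp only [reducedLogCounting]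
  linarith

end IsTranscendentalMeromorphic

end

section

variable {f : ℂ → ℂ} {a : ℂ} {k : ℕ} {q : ℕ → ℕ}

/-! ### Exceptional sets and omitted values -/

lemma isSmallRemainder_of_isBigO (hf : IsTranscendentalMeromorphic f) {S : ℝ → ℝ}
    (hS : S =O[atTopOffFinite] logGauge f) : IsSmallRemainder S f := by
  obtain ⟨C, hC⟩ := hS.bound
  obtain ⟨A, hA, B, hB, hAB⟩ := mem_inf_iff_superset.1 hC
  refine ⟨toMeasurable volume Bᶜ ∩ Ioi 0, inter_subset_right,
    (measurableSet_toMeasurable _ _).inter measurableSet_Ioi, ?_, ?_⟩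
  · refine (measure_mono inter_subset_left).trans_lt ?_
    rw [measure_toMeasurable]
    exact Measure.mem_cofinite.1 hB
  · refine IsBigO.trans_isLittleO (IsBigO.of_bound C ?_)
      (hf.logGauge_isLittleO_atTop.mono inf_le_left)
    filter_upwards [mem_inf_of_left hA, mem_inf_of_left (Ioi_mem_atTop (0 : ℝ)),
      mem_inf_of_right (mem_principal_self _)] with r h1 h2 h3
    refine hAB ⟨h1, ?_⟩
    by_contra h4
    exact h3 ⟨subset_toMeasurable _ _ h4, h2⟩

lemma monomial_div (a c : ℂ) (k : ℕ) (q : ℕ → ℕ) (f : ℂ → ℂ) :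
    monomial (a / c) k q f = fun z ↦ monomial a k q f z / c := by
  ext z
  simp only [monomial]
  ring

/-- The poles of `1 / (g - 1)` are the points at which `g` takes the value `1`. -/
lemma tendsto_one_of_reducedPoleDivisor_ne_zero {g : ℂ → ℂ} (hg : Meromorphic g) {z : ℂ}
    (h : reducedPoleDivisor (fun w ↦ 1 / (g w - 1)) z ≠ 0) : Tendsto g (𝓝[≠] z) (𝓝 1) := by
  have hsub : Meromorphic fun w ↦ g w - 1 := fun w ↦ (hg w).fun_sub (MeromorphicAt.const 1 w)
  have hinv : Meromorphic fun w ↦ 1 / (g w - 1) :=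
    fun w ↦ (MeromorphicAt.const 1 w).fun_div (hsub w)
  have h1 : divisor (fun w ↦ 1 / (g w - 1)) univ z < 0 := by
    by_contra hn
    exact h (if_neg hn)
  rw [divisor_apply hinv.meromorphicOn (mem_univ z)] at h1
  simp_rw [one_div] at h1
  have h2 : meromorphicOrderAt (fun w ↦ (g w - 1)⁻¹) z = -meromorphicOrderAt (fun w ↦ g w - 1) z :=
    meromorphicOrderAt_inv (f := fun w ↦ g w - 1)
  rw [h2] at h1
  have h3 : 0 < meromorphicOrderAt (fun w ↦ g w - 1) z := by
    revert h1
    cases meromorphicOrderAt (fun w ↦ g w - 1) z with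
    | top => simp
    | coe n =>
      intro h1
      have h4 : -n < 0 := h1
      exact_mod_cast neg_lt_zero.1 h4
  have h4 := (tendsto_zero_of_meromorphicOrderAt_pos h3).add_const 1
  simpa using h4

namespace IsTranscendentalMeromorphic

/-- `M` takes the value `1` infinitely often: otherwise `N̄(r, 1 / (M - 1)) = O(log r)`, and the main
inequality bounds `T(r, f)` by a quantity of logarithmic size. -/
theorem infinite_setOf_tendsto_one (hf : IsTranscendentalMeromorphic f) (ha : a ≠ 0)
    (hq0 : 1 ≤ q 0) (hμ : (0 : ℝ) < (degree k q : ℝ) - starDegree k q - 2) :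
    {z : ℂ | Tendsto (monomial a k q f) (𝓝[≠] z) (𝓝 1)}.Infinite := by
  intro hfin
  have hN : reducedLogCounting (fun z ↦ 1 / (monomial a k q f z - 1)) =O[atTop] log :=
    Function.locallyFinsuppWithin.logCounting_isBigO_log_of_finite_support
      (hfin.subset fun z hz ↦ tendsto_one_of_reducedPoleDivisor_ne_zero
        (meromorphic_monomial hf.1 a k q) hz)
  obtain ⟨e, he, hle⟩ := hf.exists_mul_characteristic_le (k := k) ha hq0
  have h1 : (fun r ↦ ((degree k q : ℝ) - starDegree k q - 2) * characteristic f ⊤ r)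
      =O[atTopOffFinite] logGauge f :=
    (isBigO_of_le fun r hr ↦ ⟨mul_nonneg hμ.le (characteristic_nonneg hr), hle r hr⟩).trans
      (((hN.mono atTopOffFinite_le_atTop).trans (log_isBigO_logGauge f)).add he)
  exact hf.not_characteristic_isBigO_logGauge ((isBigO_const_mul_left_iff hμ.ne').1 h1)

end IsTranscendentalMeromorphic

end

end DiffMonomial

theorem theorem2p2 (f : ℂ → ℂ) (hf : DiffMonomial.IsTranscendentalMeromorphic f)
    (a : ℂ) (ha : a ≠ 0) (k : ℕ) (hk : 1 ≤ k) (q : ℕ → ℕ) (hq0 : 1 ≤ q 0) (hqk : 1 ≤ q k)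
    (hμ : (3 : ℤ) ≤ (DiffMonomial.degree k q : ℤ) - (DiffMonomial.starDegree k q : ℤ)) :
    (∃ S : ℝ → ℝ, DiffMonomial.IsSmallRemainder S f ∧
      ∀ r : ℝ, 0 < r →
        ValueDistribution.characteristic f ⊤ r ≤
          1 / ((DiffMonomial.degree k q : ℝ) - (DiffMonomial.starDegree k q : ℝ) - 2) *
            DiffMonomial.reducedLogCounting
              (fun z ↦ 1 / (DiffMonomial.monomial a k q f z - 1)) r + S r) ∧
    (∀ c : ℂ, c ≠ 0 →
      {z : ℂ | Tendsto (DiffMonomial.monomial a k q f) (𝓝[≠] z) (𝓝 c)}.Infinite) := by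
  have hμ' : (0 : ℝ) < (DiffMonomial.degree k q : ℝ) - DiffMonomial.starDegree k q - 2 := by
    have : (3 : ℝ) ≤ (DiffMonomial.degree k q : ℝ) - DiffMonomial.starDegree k q := by
      exact_mod_cast hμ
    linarith
  refine ⟨?_, fun c hc ↦ ?_⟩
  · obtain ⟨e, he, hle⟩ := hf.exists_mul_characteristic_le (k := k) ha hq0
    set d : ℝ := (DiffMonomial.degree k q : ℝ) - DiffMonomial.starDegree k q - 2
    set N := DiffMonomial.reducedLogCounting
      fun z ↦ 1 / (DiffMonomial.monomial a k q f z - 1)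
    -- the positive part makes the inequality hold for all `r`, and costs nothing for large `r`
    refine ⟨fun r ↦ max 0 (ValueDistribution.characteristic f ⊤ r - 1 / d * N r),
      DiffMonomial.isSmallRemainder_of_isBigO hf ?_, fun r _ ↦ ?_⟩
    · have h1 : (fun r ↦ max 0 (ValueDistribution.characteristic f ⊤ r - 1 / d * N r))
          =O[DiffMonomial.atTopOffFinite] fun r ↦ ‖1 / d * e r‖ := by
        refine DiffMonomial.isBigO_of_le fun r hr ↦
          ⟨le_max_left _ _, max_le (norm_nonneg _) (le_trans ?_ (le_abs_self _))⟩
        have h2 := mul_le_mul_of_nonneg_left (hle r hr) (one_div_pos.2 hμ').le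
        rw [← mul_assoc, one_div_mul_cancel hμ'.ne', one_mul] at h2
        linarith
      exact h1.trans (he.const_mul_left _).norm_left
    · have := le_max_right 0 (ValueDistribution.characteristic f ⊤ r - 1 / d * N r)
      linarith
  · have h1 := hf.infinite_setOf_tendsto_one (k := k) (div_ne_zero ha hc) hq0 hμ'
    refine h1.mono fun z hz ↦ ?_
    simp only [Set.mem_ofPred_eq, DiffMonomial.monomial_div] at hz ⊢
    simpa [div_mul_cancel₀ _ hc] using hz.mul_const c
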